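/- **Setting.** Let $T>0$ and consider the problem of minimizing $\varphi_0(x_0,x_T)$ subject to $\dot x_t=F(x_t,u_t,v_t)$ a.e. on $[0,T]$, $\eta_j(x_0,x_T)=0$ $(1\le j\le d_\eta)$ and $\varphi_i(x_0,x_T)\le 0$ $(1\le i\le d_\varphi)$, where $F(x,u,v)=f_0(x,u)+\sum_{i=1}^m v_if_i(x,u)$, $x\in W^{1,\infty}(0,T;\mathbb R^n)$, $u\in L^\infty(0,T;\mathbb R^l)$, $v\in L^\infty(0,T;\mathbb R^m)$. The functions $f_i:\mathbb R^{n+l}\to\mathbb R^n$, $\varphi_i,\eta_j:\mathbb R^{2n}\to\mathbb R$ have Lipschitz continuous second derivatives. Let $\hat w=(\hat x,\hat u,\hat v)$ be a feasible trajectory with $\varphi_i(\hat x_0,\hat x_T)=0$ for $1\le i\le d_\varphi$ and with $\hat u,\hat v$ continuously differentiable on $[0,T]$. Omitted arguments are taken along $\hat w$. **Multipliers.** For $\lambda=(\alpha,\beta,p)\in\mathbb R^{d_\varphi+1}\times\mathbb R^{d_\eta}\times W^{1,\infty}(0,T;\mathbb R^{n})$ put $H[\lambda](x,u,v,t)=p_t\cdot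 F(x,u,v)$ and $\ell[\lambda]=\sum_{i=0}^{d_\varphi}\alpha_i\varphi_i+\sum_{j=1}^{d_\eta}\beta_j\eta_j$. Let $\Lambda$ be the set of (Lagrange) multipliers, i.e. of the $\lambda$ with $|\alpha|+|\beta|=1$, $\alpha\ge0$, $-\dot p=H_x[\lambda]$, $p_0=-D_{x_0}\ell[\lambda](\hat x_0,\hat x_T)$, $p_T=D_{x_T}\ell[\lambda](\hat x_0,\hat x_T)$, and $H_u[\lambda]=0$, $H_v[\lambda]=0$ a.e. on $[0,T]$. Let $\mathcal H_2$ be the set of $(\bar x,\bar u,\bar v)\in W^{1,2}\times L^2\times L^2$ with $\dot{\bar x}=F_x\bar x+F_u\bar u+F_v\bar v$, and $$\Omega[\lambda](\bar x,\bar u,\bar v)=\tfrac12D^2\ell[\lambda](\hat x_0,\hat x_T)(\bar x_0,\bar x_T)^2+\int_0^T\big(\tfrac12\bar x^\top H_{xx}\bar x+\bar u^\top H_{ux}\bar x+\bar v^\top H_{vx}\bar x+\tfrac12\bar u^\top H_{uu}\bar u+\bar v^\top H_{vu}\bar u\big)\,dt .$$ Let $\Lambda^{\#}$ be the set of $\lambda\in\Lambda$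 for which $\Omega[\lambda]$ is weakly (sequentially) lower semicontinuous on $\mathcal H_2$. **Transformed quantities.** Put $B=F_xF_v-\frac{d}{dt}F_v$ and, for each $\lambda$, $M=F_v^\top H_{xx}-\dot H_{vx}-H_{vx}F_x$, $E=F_v^\top H_{ux}^\top-H_{vx}F_u$, $S=\frac12(H_{vx}F_v+(H_{vx}F_v)^\top)$, $V=\frac12(H_{vx}F_v-(H_{vx}F_v)^\top)$, and $R=F_v^\top H_{xx}F_v-(H_{vx}B+(H_{vx}B)^\top)-\dot S$. Let $G(\mathrm{co}\,\Lambda^{\#})$ be the set of $\lambda$ in the convex hull of $\Lambda^{\#}$ with $V[\lambda]\equiv0$ on $[0,T]$. Let $\mathcal P_2$ be the set of $(\bar\xi,\bar u,\bar y,\bar h)\in W^{1,2}(0,T;\mathbb R^n)\times L^2(0,T;\mathbb R^l)\times L^2(0,T;\mathbb R^m)\times\mathbb R^m$ such that $\dot{\bar\xi}=F_x\bar\xi+F_u\bar u+B\bar y$ a.e. on $[0,T]$, $D\eta_j(\hat x_0,\hat x_T)(\bar\xi_0,\bar\xi_T+F_{v,T}\bar h)=0$ for $1\le j\le d_\eta$,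 and $D\varphi_i(\hat x_0,\hat x_T)(\bar\xi_0,\bar\xi_T+F_{v,T}\bar h)\le0$ for $0\le i\le d_\varphi$. On $\mathcal P_2$ let $\gamma_{\mathcal P}(\bar\xi_0,\bar u,\bar y,\bar h)=|\bar\xi_0|^2+|\bar h|^2+\int_0^T(|\bar u_t|^2+|\bar y_t|^2)\,dt$ and $$\begin{aligned}\Omega_{\mathcal P_2}[\lambda](\bar\xi,\bar u,\bar y,\bar h)={}&\tfrac12D^2\ell[\lambda](\hat x_0,\hat x_T)(\bar\xi_0,\bar\xi_T+F_{v,T}\bar h)^2+\bar h^\top\big(H_{vx,T}\bar\xi_T+\tfrac12S_T\bar h\big)\\&+\int_0^T\big(\tfrac12\bar\xi^\top H_{xx}\bar\xi+\bar u^\top H_{ux}\bar\xi+\bar y^\top M\bar\xi+\tfrac12\bar u^\top H_{uu}\bar u+\bar y^\top E\bar u+\tfrac12\bar y^\top R\bar y\big)\,dt .\end{aligned}$$ **Statement.** Let $\rho>0$ and suppose that $$\max_{\lambda\in G(\mathrm{co}\,\Lambda^{\#})}\Omega_{\mathcal P_2}[\lambda](\bar\xi,\bar u,\bar y,\bar h)\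 \ge\ \rho\,\gamma_{\mathcal P}(\bar\xi_0,\bar u,\bar y,\bar h)\qquad\text{for all }(\bar\xi,\bar u,\bar y,\bar h)\in\mathcal P_2,$$ and that $\hat w$ has a unique multiplier, $\Lambda=\{\lambda\}$. Then, for this $\lambda$ and the same $\rho$, $$\begin{pmatrix}H_{uu}[\lambda]&E[\lambda]^\top\\E[\lambda]&R[\lambda]\end{pmatrix}\succeq\rho I\qquad\text{at every }t\in[0,T].$$ -/

import Mathlib

open MeasureTheory Filter Topology Matrix

noncomputable section

namespace SingularControl

/-! ### Partial derivatives, one block of variables at a time -/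

/-- The gradient of `g` at `x`: entry `i` is `∂g/∂x_i`. -/
def grad {a : ℕ} (g : (Fin a → ℝ) → ℝ) (x : Fin a → ℝ) : Fin a → ℝ :=
  fun i => fderiv ℝ g x (Pi.single i 1)

/-- The Jacobian matrix of `g` at `x`: entry `(i, j)` is `∂g_i/∂x_j`. -/
def jac {a b : ℕ} (g : (Fin a → ℝ) → (Fin b → ℝ)) (x : Fin a → ℝ) :
    Matrix (Fin b) (Fin a) ℝ :=
  Matrix.of fun i j => fderiv ℝ g x (Pi.single j 1) i

/-- Entrywise time derivative on `[0,T]` of a matrix function (one-sided at the endpoints). -/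
def timeDeriv (T : ℝ) {a b : ℕ} (A : ℝ → Matrix (Fin a) (Fin b) ℝ) (t : ℝ) :
    Matrix (Fin a) (Fin b) ℝ :=
  Matrix.of fun i j => derivWithin (fun s => A s i j) (Set.Icc 0 T) t

/-- The squared Euclidean norm. -/
def normSq {a : ℕ} (z : Fin a → ℝ) : ℝ := z ⬝ᵥ z

/-! ### Function spaces on `[0,T]` -/

/-- Lebesgue measure on `[0,T]`. -/
def timeMeasure (T : ℝ) : Measure ℝ := volume.restrict (Set.Icc 0 T)

/-- `x` is (the continuous representative of) an element of `W^{1,q}(0,T; ℝ^a)` and `ẋ = g` a.e.: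
`g` is in `L^q` and `x` is a primitive of `g` on `[0,T]`. -/
def HasSobolevDeriv (T : ℝ) (q : ENNReal) {a : ℕ} (x g : ℝ → Fin a → ℝ) : Prop :=
  MemLp g q (timeMeasure T) ∧
    ∀ t ∈ Set.Icc (0 : ℝ) T, x t = x 0 + ∫ s in (0 : ℝ)..t, g s

/-- Weak convergence in `L²(0,T; ℝ^a)`. -/
def WeakTendstoL2 (T : ℝ) {a : ℕ} (z : ℕ → ℝ → Fin a → ℝ) (z₀ : ℝ → Fin a → ℝ) : Prop :=
  ∀ ψ : ℝ → Fin a → ℝ, MemLp ψ 2 (timeMeasure T) →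
    Tendsto (fun k => ∫ t in (0 : ℝ)..T, ψ t ⬝ᵥ z k t) atTop
      (𝓝 (∫ t in (0 : ℝ)..T, ψ t ⬝ᵥ z₀ t))

/-! ### The optimal control problem -/

/-- The data: horizon `T`, vector fields `f_0, …, f_m` on `ℝ^n × ℝ^l`, cost and inequality
functions `φ_0, …, φ_dφ` and equality functions `η_1, …, η_dη` of `(x_0, x_T)`. -/
structure Problem (n l m dφ dη : ℕ) where
  T : ℝ
  f : Fin (m + 1) → (Fin n → ℝ) × (Fin l → ℝ) → (Fin n → ℝ)
  φ : Fin (dφ + 1) → (Fin n → ℝ) × (Fin n → ℝ) → ℝ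
  η : Fin dη → (Fin n → ℝ) × (Fin n → ℝ) → ℝ

/-- A function is of class `C²` with Lipschitz continuous second derivative. -/
def HasLipschitzSecondDeriv {X Y : Type*} [NormedAddCommGroup X] [NormedSpace ℝ X]
    [NormedAddCommGroup Y] [NormedSpace ℝ Y] (g : X → Y) : Prop :=
  ContDiff ℝ 2 g ∧ ∃ K, LipschitzWith K (iteratedFDeriv ℝ 2 g)

/-- A point `w = (x, u, v)`. -/
structure Point (n l m : ℕ) where
  x : ℝ → Fin n → ℝ
  u : ℝ → Fin l → ℝ
  v : ℝ → Fin m → ℝ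

/-- The space of `λ = (α, β, p)`. -/
abbrev Mult (n dφ dη : ℕ) : Type :=
  (Fin (dφ + 1) → ℝ) × (Fin dη → ℝ) × (ℝ → Fin n → ℝ)

namespace Problem

variable {n l m dφ dη : ℕ} (P : Problem n l m dφ dη)

/-- All data functions have Lipschitz continuous second derivatives. -/
def Regular : Prop :=
  (∀ i, HasLipschitzSecondDeriv (P.f i)) ∧ (∀ i, HasLipschitzSecondDeriv (P.φ i)) ∧
    ∀ j, HasLipschitzSecondDeriv (P.η j)

/-- `F(x,u,v) = ∑_{i=0}^m v_i f_i(x,u)` with `v_0 = 1`. -/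
def F (x : Fin n → ℝ) (u : Fin l → ℝ) (v : Fin m → ℝ) : Fin n → ℝ :=
  ∑ i, (Fin.cons 1 v : Fin (m + 1) → ℝ) i • P.f i (x, u)

/-- The pre-Hamiltonian `p F(x,u,v)`, as a function of the value `p` of the costate. -/
def H (p x : Fin n → ℝ) (u : Fin l → ℝ) (v : Fin m → ℝ) : ℝ := p ⬝ᵥ P.F x u v

/-- The endpoint Lagrangian. -/
def ell (μ : Mult n dφ dη) (q : (Fin n → ℝ) × (Fin n → ℝ)) : ℝ :=
  ∑ i, μ.1 i * P.φ i q + ∑ j, μ.2.1 j * P.η j q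

/-- `w` is a feasible trajectory: it lies in `W^{1,∞} × L^∞ × L^∞` and satisfies the state
equation and the endpoint constraints. -/
structure IsFeasible (w : Point n l m) : Prop where
  memLp_u : MemLp w.u ⊤ (timeMeasure P.T)
  memLp_v : MemLp w.v ⊤ (timeMeasure P.T)
  state_eq : HasSobolevDeriv P.T ⊤ w.x (fun t => P.F (w.x t) (w.u t) (w.v t))
  eq_constraints : ∀ j, P.η j (w.x 0, w.x P.T) = 0
  ineq_constraints : ∀ i : Fin dφ, P.φ i.succ (w.x 0, w.x P.T) ≤ 0

/-! Derivatives along the reference trajectory `w`. -/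

variable (w : Point n l m)

def Fx (t : ℝ) : Matrix (Fin n) (Fin n) ℝ := jac (fun x => P.F x (w.u t) (w.v t)) (w.x t)

def Fu (t : ℝ) : Matrix (Fin n) (Fin l) ℝ := jac (fun u => P.F (w.x t) u (w.v t)) (w.u t)

def Fv (t : ℝ) : Matrix (Fin n) (Fin m) ℝ := jac (fun v => P.F (w.x t) (w.u t) v) (w.v t)

variable (μ : Mult n dφ dη)

def Hx (t : ℝ) : Fin n → ℝ := grad (fun x => P.H (μ.2.2 t) x (w.u t) (w.v t)) (w.x t)

def Hu (t : ℝ) : Fin l → ℝ := grad (fun u => P.H (μ.2.2 t) (w.x t) u (w.v t)) (w.u t)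

def Hv (t : ℝ) : Fin m → ℝ := grad (fun v => P.H (μ.2.2 t) (w.x t) (w.u t) v) (w.v t)

def Hxx (t : ℝ) : Matrix (Fin n) (Fin n) ℝ :=
  jac (fun x => grad (fun x' => P.H (μ.2.2 t) x' (w.u t) (w.v t)) x) (w.x t)

def Hux (t : ℝ) : Matrix (Fin l) (Fin n) ℝ :=
  jac (fun x => grad (fun u => P.H (μ.2.2 t) x u (w.v t)) (w.u t)) (w.x t)

def Hvx (t : ℝ) : Matrix (Fin m) (Fin n) ℝ :=
  jac (fun x => grad (fun v => P.H (μ.2.2 t) x (w.u t) v) (w.v t)) (w.x t)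

def Huu (t : ℝ) : Matrix (Fin l) (Fin l) ℝ :=
  jac (fun u => grad (fun u' => P.H (μ.2.2 t) (w.x t) u' (w.v t)) u) (w.u t)

def Hvu (t : ℝ) : Matrix (Fin m) (Fin l) ℝ :=
  jac (fun u => grad (fun v => P.H (μ.2.2 t) (w.x t) u v) (w.v t)) (w.u t)

/-- The quadratic form `D²ℓ[λ](x_0, x_T)(ζ)²`. -/
def D2ell (ζ : (Fin n → ℝ) × (Fin n → ℝ)) : ℝ :=
  fderiv ℝ (fderiv ℝ (P.ell μ)) (w.x 0, w.x P.T) ζ ζ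

/-- `λ = (α, β, p)` is a Lagrange multiplier associated with `w`. -/
structure IsMultiplier : Prop where
  nontrivial : Real.sqrt (normSq μ.1) + Real.sqrt (normSq μ.2.1) = 1
  nonneg : ∀ i, 0 ≤ μ.1 i
  costate : HasSobolevDeriv P.T ⊤ μ.2.2 (fun t => - P.Hx w μ t)
  transv_zero : μ.2.2 0 = - grad (fun a => P.ell μ (a, w.x P.T)) (w.x 0)
  transv_T : μ.2.2 P.T = grad (fun b => P.ell μ (w.x 0, b)) (w.x P.T)
  stat_u : ∀ᵐ t ∂(timeMeasure P.T), P.Hu w μ t = 0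
  stat_v : ∀ᵐ t ∂(timeMeasure P.T), P.Hv w μ t = 0

/-- The set `Λ` of Lagrange multipliers. -/
def Multipliers : Set (Mult n dφ dη) := {μ | P.IsMultiplier w μ}

/-- `λ` is the only Lagrange multiplier. The costate is a function on `[0,T]`; its values at
other times are irrelevant. -/
def IsUniqueMultiplier : Prop :=
  μ ∈ P.Multipliers w ∧ ∀ ν ∈ P.Multipliers w,
    ν.1 = μ.1 ∧ ν.2.1 = μ.2.1 ∧ Set.EqOn ν.2.2 μ.2.2 (Set.Icc 0 P.T)

/-! ### The second variation and the set `Λ^#` -/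

/-- The right-hand side of the linearized state equation in the direction `d`. -/
def linRhs (d : Point n l m) (t : ℝ) : Fin n → ℝ :=
  P.Fx w t *ᵥ d.x t + P.Fu w t *ᵥ d.u t + P.Fv w t *ᵥ d.v t

/-- The space `H_2` of directions in `W^{1,2} × L² × L²` satisfying the linearized equation. -/
def H2 : Set (Point n l m) :=
  {d | MemLp d.u 2 (timeMeasure P.T) ∧ MemLp d.v 2 (timeMeasure P.T) ∧
    HasSobolevDeriv P.T 2 d.x (P.linRhs w d)}

/-- The second variation `Ω[λ]` of the Lagrangian. -/
def Omega (d : Point n l m) : ℝ :=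
  (1 / 2) * P.D2ell w μ (d.x 0, d.x P.T) +
    ∫ t in (0 : ℝ)..P.T,
      ((1 / 2) * (d.x t ⬝ᵥ P.Hxx w μ t *ᵥ d.x t) + d.u t ⬝ᵥ P.Hux w μ t *ᵥ d.x t
        + d.v t ⬝ᵥ P.Hvx w μ t *ᵥ d.x t + (1 / 2) * (d.u t ⬝ᵥ P.Huu w μ t *ᵥ d.u t)
        + d.v t ⬝ᵥ P.Hvu w μ t *ᵥ d.u t)

/-- Weak convergence in `H_2 ⊆ W^{1,2} × L² × L²`: the states, their derivatives and the two
controls converge weakly in `L²`. -/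
def WeakTendstoH2 (d : ℕ → Point n l m) (d₀ : Point n l m) : Prop :=
  WeakTendstoL2 P.T (fun k => (d k).x) d₀.x ∧
    WeakTendstoL2 P.T (fun k => P.linRhs w (d k)) (P.linRhs w d₀) ∧
    WeakTendstoL2 P.T (fun k => (d k).u) d₀.u ∧ WeakTendstoL2 P.T (fun k => (d k).v) d₀.v

/-- The set `Λ^#` of multipliers for which `Ω[λ]` is weakly (sequentially) lower semicontinuous
on `H_2`. -/
def MultipliersSharp : Set (Mult n dφ dη) :=
  {μ | μ ∈ P.Multipliers w ∧
    ∀ (d : ℕ → Point n l m) (d₀ : Point n l m), (∀ k, d k ∈ P.H2 w) → d₀ ∈ P.H2 w →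
      P.WeakTendstoH2 w d d₀ →
      ∀ c < P.Omega w μ d₀, ∀ᶠ k in atTop, c < P.Omega w μ (d k)}

/-! ### Goh's transformation -/

/-- `B = F_x F_v - (d/dt) F_v`. -/
def B (t : ℝ) : Matrix (Fin n) (Fin m) ℝ :=
  P.Fx w t * P.Fv w t - timeDeriv P.T (P.Fv w) t

/-- `M = F_vᵀ H_xx - (d/dt) H_vx - H_vx F_x`. -/
def M (t : ℝ) : Matrix (Fin m) (Fin n) ℝ :=
  (P.Fv w t)ᵀ * P.Hxx w μ t - timeDeriv P.T (P.Hvx w μ) t - P.Hvx w μ t * P.Fx w t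

/-- `E = F_vᵀ H_uxᵀ - H_vx F_u`. -/
def E (t : ℝ) : Matrix (Fin m) (Fin l) ℝ :=
  (P.Fv w t)ᵀ * (P.Hux w μ t)ᵀ - P.Hvx w μ t * P.Fu w t

/-- The symmetric part of `H_vx F_v`. -/
def S (t : ℝ) : Matrix (Fin m) (Fin m) ℝ :=
  (1 / 2 : ℝ) • (P.Hvx w μ t * P.Fv w t + (P.Hvx w μ t * P.Fv w t)ᵀ)

/-- The skew-symmetric part of `H_vx F_v`. -/
def V (t : ℝ) : Matrix (Fin m) (Fin m) ℝ :=
  (1 / 2 : ℝ) • (P.Hvx w μ t * P.Fv w t - (P.Hvx w μ t * P.Fv w t)ᵀ)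

/-- `R = F_vᵀ H_xx F_v - (H_vx B + (H_vx B)ᵀ) - (d/dt) S`. -/
def R (t : ℝ) : Matrix (Fin m) (Fin m) ℝ :=
  (P.Fv w t)ᵀ * P.Hxx w μ t * P.Fv w t
    - (P.Hvx w μ t * P.B w t + (P.Hvx w μ t * P.B w t)ᵀ) - timeDeriv P.T (P.S w μ) t

/-- The set `G(co Λ^#)`. -/
def GcoSharp : Set (Mult n dφ dη) :=
  {μ | μ ∈ convexHull ℝ (P.MultipliersSharp w) ∧ ∀ t ∈ Set.Icc (0 : ℝ) P.T, P.V w μ t = 0}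

/-- The endpoint term `g[λ](ζ_0, ζ_T, h)`. -/
def g (ζ₀ ζT : Fin n → ℝ) (h : Fin m → ℝ) : ℝ :=
  (1 / 2) * P.D2ell w μ (ζ₀, ζT + P.Fv w P.T *ᵥ h)
    + h ⬝ᵥ (P.Hvx w μ P.T *ᵥ ζT + (1 / 2 : ℝ) • (P.S w μ P.T *ᵥ h))

end Problem

/-- A transformed direction `(ξ, u, y, h)`. -/
structure TDir (n l m : ℕ) where
  ξ : ℝ → Fin n → ℝ
  u : ℝ → Fin l → ℝ
  y : ℝ → Fin m → ℝ
  h : Fin m → ℝ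

namespace Problem

variable {n l m dφ dη : ℕ} (P : Problem n l m dφ dη) (w : Point n l m) (μ : Mult n dφ dη)

/-- The transformed critical cone `P_2 ⊆ W^{1,2} × L² × L² × ℝ^m`. -/
def P2 : Set (TDir n l m) :=
  {d | MemLp d.u 2 (timeMeasure P.T) ∧ MemLp d.y 2 (timeMeasure P.T) ∧
    HasSobolevDeriv P.T 2 d.ξ
      (fun t => P.Fx w t *ᵥ d.ξ t + P.Fu w t *ᵥ d.u t + P.B w t *ᵥ d.y t) ∧
    (∀ j, fderiv ℝ (P.η j) (w.x 0, w.x P.T) (d.ξ 0, d.ξ P.T + P.Fv w P.T *ᵥ d.h) = 0) ∧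
    ∀ i, fderiv ℝ (P.φ i) (w.x 0, w.x P.T) (d.ξ 0, d.ξ P.T + P.Fv w P.T *ᵥ d.h) ≤ 0}

/-- The transformed second variation on `P_2`. -/
def OmegaP2 (d : TDir n l m) : ℝ :=
  P.g w μ (d.ξ 0) (d.ξ P.T) d.h +
    ∫ t in (0 : ℝ)..P.T,
      ((1 / 2) * (d.ξ t ⬝ᵥ P.Hxx w μ t *ᵥ d.ξ t) + d.u t ⬝ᵥ P.Hux w μ t *ᵥ d.ξ t
        + d.y t ⬝ᵥ P.M w μ t *ᵥ d.ξ t + (1 / 2) * (d.u t ⬝ᵥ P.Huu w μ t *ᵥ d.u t)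
        + d.y t ⬝ᵥ P.E w μ t *ᵥ d.u t + (1 / 2) * (d.y t ⬝ᵥ P.R w μ t *ᵥ d.y t))

/-- The order `γ_P(ξ_0, u, y, h)`. -/
def gammaP (d : TDir n l m) : ℝ :=
  normSq (d.ξ 0) + normSq d.h + ∫ t in (0 : ℝ)..P.T, (normSq (d.u t) + normSq (d.y t))

/-- Uniform positivity with constant `ρ`: on `P_2`, the maximum of `Ω_{P_2}[λ]` over
`λ ∈ G(co Λ^#)` is at least `ρ γ_P`. -/
def UniformPositivity (ρ : ℝ) : Prop :=
  ∀ d ∈ P.P2 w, ∃ c, IsGreatest ((fun μ => P.OmegaP2 w μ d) '' P.GcoSharp w) c ∧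
    ρ * P.gammaP d ≤ c

/-- The block matrix `[[H_uu, Eᵀ], [E, R]]`. -/
def blockMatrix (t : ℝ) : Matrix (Fin l ⊕ Fin m) (Fin l ⊕ Fin m) ℝ :=
  Matrix.fromBlocks (P.Huu w μ t) (P.E w μ t)ᵀ (P.E w μ t) (P.R w μ t)

end Problem

end SingularControl

end

noncomputable section

namespace SingularControl

/-! ### Controls concentrated near a time, with vanishing terminal state -/

section LinearODE

variable {E : Type*} [NormedAddCommGroup E] [NormedSpace ℝ E]

/-! Uniqueness of the multiplier removes the maximum: every element of `GcoSharp` agrees with the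
given multiplier up to irrelevant costate values outside `[0,T]`. The positivity hypothesis
therefore says that the single quadratic form `OmegaP2` dominates `ρ * gammaP` on the critical cone
(`UniformPositivity.le_OmegaP2`).

The rest is a Legendre-type needle argument. Fix `t₀ < T` and constant vectors `u₀`, `y₀`, and use
controls `a • u₀`, `a • y₀` with a scalar `a` living on a short interval `[t₀, s]` and normalized by
`∫ a² = 1`. The cone imposes endpoint conditions, so a generic needle would not be admissible. It
becomes so if the state returns to `0` at time `s` and `h = 0`: all linearized endpoint constraints
then hold trivially, and the endpoint part of the quadratic form vanishes. Such an `a` exists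
because the map from controls to states at time `s` is linear into a finite-dimensional space, so it
has a nontrivial kernel on polynomials of large enough degree (`exists_control_ne_zero`).

On a short interval `∫ |a|` is small, hence so is the state (`norm_le_of_linear_ode`). Only the term
quadratic in the controls survives in the limit, and by continuity it tends to its coefficient at
`t₀` (`le_of_forall_concentrated_control`). The time `T` is reached by continuity. That coefficient
is half the quadratic form of the block matrix, so the argument gives the bound `2ρ`, which is
stronger than the bound `ρ` claimed. -/

lemma integral_eq_sub_of_hasDerivWithinAt_Icc [CompleteSpace E] {f g : ℝ → E} {a b t : ℝ}
    (hf : ∀ r ∈ Set.Icc a b, HasDerivWithinAt f (g r) (Set.Icc a b) r)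
    (hg : ContinuousOn g (Set.Icc a b)) (ht : t ∈ Set.Icc a b) :
    ∫ r in a..t, g r = f t - f a := by
  have hsub : Set.Icc a t ⊆ Set.Icc a b := Set.Icc_subset_Icc_right ht.2
  refine intervalIntegral.integral_eq_sub_of_hasDerivAt_of_le ht.1
    (fun r hr => ((hf r (hsub hr)).continuousWithinAt).mono hsub) (fun r hr => ?_)
    ((hg.mono (by rwa [Set.uIcc_of_le ht.1])).intervalIntegrable)
  exact (hf r (hsub (Set.Ioo_subset_Icc_self hr))).hasDerivAt
    (Icc_mem_nhds hr.1 (hr.2.trans_le ht.2))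

/-- Picard–Lindelöf on the ball of radius `r = 2β(s - t₀)`, where `β` bounds `b`. The field is
bounded there by `K r + β`, and `(s - t₀) K ≤ 1/2` gives `(s - t₀)(K r + β) ≤ r/2 + r/2`, so
solutions stay in the ball up to time `s`. -/
lemma exists_linear_ode_solution [CompleteSpace E] {A : ℝ → E →L[ℝ] E} {b : ℝ → E} {t₀ s K : ℝ}
    (hle : t₀ ≤ s) (hA : ContinuousOn A (Set.Icc t₀ s)) (hb : ContinuousOn b (Set.Icc t₀ s))
    (hK : ∀ t ∈ Set.Icc t₀ s, ‖A t‖ ≤ K) (hs : (s - t₀) * K ≤ 1 / 2) :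
    ∃ ξ : ℝ → E, ξ t₀ = 0 ∧
      ∀ t ∈ Set.Icc t₀ s, HasDerivWithinAt ξ (A t (ξ t) + b t) (Set.Icc t₀ s) t := by
  obtain ⟨β, hβ⟩ := isCompact_Icc.exists_bound_of_continuousOn hb
  have ht₀ : t₀ ∈ Set.Icc t₀ s := Set.left_mem_Icc.2 hle
  have hK0 : 0 ≤ K := (norm_nonneg _).trans (hK _ ht₀)
  have hβ0 : 0 ≤ β := (norm_nonneg _).trans (hβ _ ht₀)
  have hd : 0 ≤ s - t₀ := sub_nonneg.2 hle
  have hpl : IsPicardLindelof (fun t x => A t x + b t) (⟨t₀, ht₀⟩ : Set.Icc t₀ s) (0 : E)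
      ⟨2 * β * (s - t₀), by positivity⟩ 0 ⟨K * (2 * β * (s - t₀)) + β, by positivity⟩
      ⟨K, hK0⟩ := by
    refine ⟨fun t ht => ?_, fun x _ => ?_, fun t ht x hx => ?_, ?_⟩
    · refine LipschitzOnWith.of_dist_le_mul fun x _ y _ => ?_
      rw [dist_add_right, dist_eq_norm, dist_eq_norm, ← map_sub]
      exact (A t).le_of_opNorm_le (hK t ht) _
    · exact (hA.clm_apply continuousOn_const).add hb
    · have hx' : ‖x‖ ≤ 2 * β * (s - t₀) := mem_closedBall_zero_iff.1 hx
      refine (norm_add_le _ _).trans (add_le_add ?_ (hβ t ht))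
      exact ((A t).le_of_opNorm_le (hK t ht) _).trans (by gcongr)
    · change (K * (2 * β * (s - t₀)) + β) * max (s - t₀) (t₀ - t₀) ≤ 2 * β * (s - t₀) - 0
      rw [sub_self, max_eq_left hd]
      have := mul_le_mul_of_nonneg_right hs (by positivity : 0 ≤ 2 * β * (s - t₀))
      nlinarith
  exact hpl.exists_eq_forall_mem_Icc_hasDerivWithinAt₀

/-- In place of Grönwall: the integral equation is evaluated at a point `c` where `‖ξ‖` is maximal.
The contribution of `A` is at most `‖ξ c‖ / 2` because the interval is short, and it is absorbed
into the left side. The bound involves only the `L¹` norm of the control, which is what tends to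
zero for concentrated controls of unit `L²` norm. -/
lemma norm_le_of_linear_ode [CompleteSpace E] {A : ℝ → E →L[ℝ] E} {b : ℝ → E} {a : ℝ → ℝ}
    {ξ : ℝ → E} {t₀ s K β : ℝ}
    (hle : t₀ ≤ s) (hA : ContinuousOn A (Set.Icc t₀ s)) (hb : ContinuousOn b (Set.Icc t₀ s))
    (ha : Continuous a)
    (hK : ∀ t ∈ Set.Icc t₀ s, ‖A t‖ ≤ K) (hs : (s - t₀) * K ≤ 1 / 2)
    (hβ : ∀ t ∈ Set.Icc t₀ s, ‖b t‖ ≤ β) (h0 : ξ t₀ = 0)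
    (hξ : ∀ t ∈ Set.Icc t₀ s,
      HasDerivWithinAt ξ (A t (ξ t) + a t • b t) (Set.Icc t₀ s) t) :
    ∀ t ∈ Set.Icc t₀ s, ‖ξ t‖ ≤ 2 * β * ∫ r in t₀..s, |a r| := by
  have ht₀ : t₀ ∈ Set.Icc t₀ s := Set.left_mem_Icc.2 hle
  have hK0 : 0 ≤ K := (norm_nonneg _).trans (hK _ ht₀)
  have hβ0 : 0 ≤ β := (norm_nonneg _).trans (hβ _ ht₀)
  have hcont : ContinuousOn ξ (Set.Icc t₀ s) := fun t ht => (hξ t ht).continuousWithinAt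
  obtain ⟨c, hc, hmax⟩ := isCompact_Icc.exists_isMaxOn ⟨t₀, ht₀⟩ hcont.norm
  have hmax' : ∀ t ∈ Set.Icc t₀ s, ‖ξ t‖ ≤ ‖ξ c‖ := hmax
  have hg : ContinuousOn (fun t => A t (ξ t) + a t • b t) (Set.Icc t₀ s) :=
    (hA.clm_apply hcont).add (ha.continuousOn.smul hb)
  have hint := integral_eq_sub_of_hasDerivWithinAt_Icc hξ hg hc
  rw [h0, sub_zero] at hint
  have hab : ∀ x y : ℝ, IntervalIntegrable (fun r => |a r|) volume x y :=
    fun x y => ha.abs.intervalIntegrable x y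
  have h1 : ‖ξ c‖ ≤ ∫ r in t₀..c, (K * ‖ξ c‖ + β * |a r|) := by
    calc ‖ξ c‖ = ‖∫ r in t₀..c, (A r (ξ r) + a r • b r)‖ := by rw [hint]
      _ ≤ _ := intervalIntegral.norm_integral_le_of_norm_le hc.1
        (Filter.Eventually.of_forall fun r hr => ?_)
        ((continuous_const.add (continuous_const.mul ha.abs)).intervalIntegrable _ _)
    have hr' : r ∈ Set.Icc t₀ s := ⟨hr.1.le, hr.2.trans hc.2⟩
    refine (norm_add_le _ _).trans (add_le_add ?_ ?_)
    · exact ((A r).le_of_opNorm_le (hK r hr') _).trans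
        (mul_le_mul_of_nonneg_left (hmax' r hr') hK0)
    · rw [norm_smul, Real.norm_eq_abs, mul_comm]
      exact mul_le_mul_of_nonneg_right (hβ r hr') (abs_nonneg _)
  have h2 : ∫ r in t₀..c, |a r| ≤ ∫ r in t₀..s, |a r| :=
    intervalIntegral.integral_mono_interval le_rfl hc.1 hc.2
      (Filter.Eventually.of_forall fun r => abs_nonneg _) (hab _ _)
  rw [intervalIntegral.integral_add (by simp) ((hab _ _).const_mul _),
    intervalIntegral.integral_const, intervalIntegral.integral_const_mul, smul_eq_mul] at h1
  have h3 : (c - t₀) * (K * ‖ξ c‖) ≤ 1 / 2 * ‖ξ c‖ := by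
    have : (c - t₀) * K ≤ (s - t₀) * K := by gcongr; exact hc.2
    nlinarith [norm_nonneg (ξ c)]
  have h4 := mul_le_mul_of_nonneg_left h2 hβ0
  intro t ht
  linarith [hmax' t ht]

/-- Dimension count: the monomials of degree `0, …, dim E` used as controls give `dim E + 1` final
states in `E`, which must be linearly dependent. The coefficients of a dependence define a nonzero
polynomial control whose final state is `0`. Having finitely many roots, it has positive `L²` norm
on the interval. -/
lemma exists_control_ne_zero [FiniteDimensional ℝ E] {A : ℝ → E →L[ℝ] E} {b : ℝ → E}
    {t₀ s K : ℝ} (hlt : t₀ < s) (hA : ContinuousOn A (Set.Icc t₀ s))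
    (hb : ContinuousOn b (Set.Icc t₀ s))
    (hK : ∀ t ∈ Set.Icc t₀ s, ‖A t‖ ≤ K) (hs : (s - t₀) * K ≤ 1 / 2) :
    ∃ (a : ℝ → ℝ) (ξ : ℝ → E), Continuous a ∧ 0 < ∫ t in t₀..s, a t ^ 2 ∧ ξ t₀ = 0 ∧ ξ s = 0 ∧
      ∀ t ∈ Set.Icc t₀ s,
        HasDerivWithinAt ξ (A t (ξ t) + a t • b t) (Set.Icc t₀ s) t := by
  have := FiniteDimensional.complete ℝ E
  set N := Module.finrank ℝ E + 1
  have hex : ∀ j : Fin N, ∃ ξ : ℝ → E, ξ t₀ = 0 ∧ ∀ t ∈ Set.Icc t₀ s,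
      HasDerivWithinAt ξ (A t (ξ t) + t ^ (j : ℕ) • b t) (Set.Icc t₀ s) t := fun j =>
    exists_linear_ode_solution hlt.le hA ((continuous_pow _).continuousOn.smul hb) hK hs
  choose ψ hψ0 hψ using hex
  have hdep : ¬ LinearIndependent ℝ (fun j => ψ j s) := fun h => by
    have := h.fintype_card_le_finrank
    simp [N] at this
  obtain ⟨c, hc, i, hi⟩ := Fintype.not_linearIndependent_iff.1 hdep
  let p : Polynomial ℝ := ∑ j : Fin N, Polynomial.monomial (j : ℕ) (c j)
  have hp : p ≠ 0 := fun h => hi <| by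
    have := congrArg (fun q => Polynomial.coeff q (i : ℕ)) h
    simpa [p, Polynomial.finsetSum_coeff, Polynomial.coeff_monomial, Fin.val_inj] using this
  have hpe : ∀ t, p.eval t = ∑ j : Fin N, c j * t ^ (j : ℕ) := fun t => by
    simp [p, Polynomial.eval_finsetSum]
  refine ⟨fun t => p.eval t, fun t => ∑ j, c j • ψ j t, p.continuous, ?_, by simp [hψ0], hc,
    fun t ht => ?_⟩
  · have hpos : ∃ x ∈ Set.Icc t₀ s, p.eval x ≠ 0 := by
      by_contra! hcon
      exact hp (Polynomial.eq_zero_of_infinite_isRoot p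
        ((Set.Icc_infinite hlt).mono fun x hx => hcon x hx))
    obtain ⟨x, hx, hpx⟩ := hpos
    exact intervalIntegral.integral_pos hlt (p.continuous.pow 2).continuousOn
      (fun t _ => sq_nonneg _) ⟨x, hx, by positivity⟩
  · have := HasDerivWithinAt.fun_sum fun j (_ : j ∈ Finset.univ) => (hψ j t ht).fun_const_smul (c j)
    convert this using 1
    simp only [hpe, smul_add, Finset.sum_add_distrib, map_sum, map_smul, Finset.sum_smul,
      smul_smul]

/-- A Cauchy–Schwarz bound, obtained by integrating the weighted inequality `2|a| ≤ δ⁻¹ + δ a²`;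
each of the two terms contributes at most `δ / 2`. -/
lemma integral_abs_le_of_integral_sq_eq_one {a : ℝ → ℝ} (ha : Continuous a) {t₀ s δ : ℝ}
    (hle : t₀ ≤ s) (hδ : 0 < δ) (hs : s - t₀ ≤ δ ^ 2) (h1 : ∫ t in t₀..s, a t ^ 2 = 1) :
    ∫ t in t₀..s, |a t| ≤ δ := by
  have hi2 : IntervalIntegrable (fun t => a t ^ 2) volume t₀ s :=
    (ha.pow 2).intervalIntegrable _ _
  have hle' : ∫ t in t₀..s, |a t| ≤ ∫ t in t₀..s, (δ⁻¹ / 2 + δ / 2 * a t ^ 2) := by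
    refine intervalIntegral.integral_mono_on hle (ha.abs.intervalIntegrable _ _)
      ((by fun_prop : Continuous fun t => δ⁻¹ / 2 + δ / 2 * a t ^ 2).intervalIntegrable _ _)
      fun t _ => ?_
    have h := mul_nonneg hδ.le (sq_nonneg (|a t| - δ⁻¹))
    have h2 : δ * δ⁻¹ = 1 := mul_inv_cancel₀ hδ.ne'
    have h3 : δ * (|a t| - δ⁻¹) ^ 2
        = δ * |a t| ^ 2 - 2 * (δ * δ⁻¹) * |a t| + (δ * δ⁻¹) * δ⁻¹ := by ring
    rw [h3, h2, sq_abs] at h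
    linarith
  rw [intervalIntegral.integral_add (by simp)
    (hi2.const_mul _), intervalIntegral.integral_const,
    intervalIntegral.integral_const_mul, h1, smul_eq_mul] at hle'
  have h5 : (s - t₀) * (δ⁻¹ / 2) ≤ δ ^ 2 * (δ⁻¹ / 2) := by gcongr
  have h6 : δ ^ 2 * (δ⁻¹ / 2) = δ / 2 := by field_simp
  linarith

/-- Controls of unit norm on arbitrarily short intervals after `t₀` that steer the linear system
from `0` back to `0` along arbitrarily small states. -/
theorem exists_concentrated_control [FiniteDimensional ℝ E] {A : ℝ → E →L[ℝ] E} {b : ℝ → E}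
    {t₀ T : ℝ} (hlt : t₀ < T) (hA : ContinuousOn A (Set.Icc t₀ T))
    (hb : ContinuousOn b (Set.Icc t₀ T)) {δ : ℝ} (hδ : 0 < δ) :
    ∃ s, t₀ < s ∧ s ≤ T ∧ s - t₀ ≤ δ ∧ ∃ (a : ℝ → ℝ) (ξ : ℝ → E),
      Continuous a ∧ ∫ t in t₀..s, a t ^ 2 = 1 ∧ ξ t₀ = 0 ∧ ξ s = 0 ∧
      (∀ t ∈ Set.Icc t₀ s,
        HasDerivWithinAt ξ (A t (ξ t) + a t • b t) (Set.Icc t₀ s) t) ∧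
      ∀ t ∈ Set.Icc t₀ s, ‖ξ t‖ ≤ δ := by
  have := FiniteDimensional.complete ℝ E
  obtain ⟨K, hK⟩ := isCompact_Icc.exists_bound_of_continuousOn hA
  obtain ⟨β, hβ⟩ := isCompact_Icc.exists_bound_of_continuousOn hb
  have ht₀ : t₀ ∈ Set.Icc t₀ T := Set.left_mem_Icc.2 hlt.le
  have hK0 : 0 ≤ K := (norm_nonneg _).trans (hK _ ht₀)
  have hβ0 : 0 ≤ β := (norm_nonneg _).trans (hβ _ ht₀)
  -- The target for `∫ |a|`: the state bound `2 * β * ∫ |a|` then stays below `δ`, and the `+ 1`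
  -- covers `β = 0`.
  set δ' := δ / (2 * β + 1) with hδ'
  have hδ'0 : 0 < δ' := by positivity
  -- The four bounds keep the interval inside `[t₀, T]`, make it shorter than `δ`, ensure `ε K ≤
  -- 1/2` for the linear equation, and make `∫ |a| ≤ δ'` after normalization.
  set ε := min (min (T - t₀) δ) (min (1 / (2 * (K + 1))) (δ' ^ 2)) with hε
  have hε0 : 0 < ε := by
    have := sub_pos.2 hlt
    positivity
  have e1 : ε ≤ T - t₀ := (min_le_left _ _).trans (min_le_left _ _)
  have e2 : ε ≤ δ := (min_le_left _ _).trans (min_le_right _ _)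
  have e3 : ε ≤ 1 / (2 * (K + 1)) := (min_le_right _ _).trans (min_le_left _ _)
  have e4 : ε ≤ δ' ^ 2 := (min_le_right _ _).trans (min_le_right _ _)
  have hsub : Set.Icc t₀ (t₀ + ε) ⊆ Set.Icc t₀ T := Set.Icc_subset_Icc_right (by linarith)
  have hKε : (t₀ + ε - t₀) * K ≤ 1 / 2 := by
    rw [add_sub_cancel_left]
    rw [le_div_iff₀ (by positivity)] at e3
    nlinarith
  obtain ⟨a, ξ, ha, hpos, h0, hs, hode⟩ := exists_control_ne_zero (by linarith : t₀ < t₀ + ε)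
    (hA.mono hsub) (hb.mono hsub) (fun t ht => hK t (hsub ht)) hKε
  set I := ∫ t in t₀..(t₀ + ε), a t ^ 2
  have hsq : (√I)⁻¹ ^ 2 * I = 1 := by
    rw [inv_pow, Real.sq_sqrt hpos.le, inv_mul_cancel₀ hpos.ne']
  have ha' : Continuous fun t => (√I)⁻¹ * a t := continuous_const.mul ha
  have hone : ∫ t in t₀..(t₀ + ε), ((√I)⁻¹ * a t) ^ 2 = 1 := by
    simp_rw [mul_pow]
    rw [intervalIntegral.integral_const_mul, hsq]
  have hode' : ∀ t ∈ Set.Icc t₀ (t₀ + ε), HasDerivWithinAt (fun t => (√I)⁻¹ • ξ t)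
      (A t ((√I)⁻¹ • ξ t) + ((√I)⁻¹ * a t) • b t) (Set.Icc t₀ (t₀ + ε)) t := fun t ht => by
    have := (hode t ht).fun_const_smul ((√I)⁻¹)
    rwa [smul_add, ← map_smul, smul_smul] at this
  refine ⟨t₀ + ε, by linarith, by linarith, by linarith, fun t => (√I)⁻¹ * a t,
    fun t => (√I)⁻¹ • ξ t, ha', hone, by simp [h0], by simp [hs], hode', fun t ht => ?_⟩
  have hb1 := norm_le_of_linear_ode (by linarith : t₀ ≤ t₀ + ε) (hA.mono hsub) (hb.mono hsub)
    ha' (fun t ht => hK t (hsub ht)) hKε (fun t ht => hβ t (hsub ht)) (by simp [h0]) hode' t ht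
  have hb2 := integral_abs_le_of_integral_sq_eq_one ha' (by linarith : t₀ ≤ t₀ + ε) hδ'0
    (by linarith) hone
  calc _ ≤ _ := hb1
    _ ≤ 2 * β * δ' := by gcongr
    _ ≤ δ := by
      rw [hδ', mul_div_assoc', div_le_iff₀ (by positivity)]
      nlinarith

/-- A Legendre-type condition: if a quadratic functional with leading coefficient `q` is at least
`κ` on the controls of unit norm steering the linear system from `0` to `0`, then
`κ ≤ q t₀`. -/
theorem le_of_forall_concentrated_control [FiniteDimensional ℝ E] {A : ℝ → E →L[ℝ] E}
    {b : ℝ → E} {Φ Ψ : ℝ → E → ℝ} {q : ℝ → ℝ} {t₀ T κ : ℝ} (hlt : t₀ < T)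
    (hA : ContinuousOn A (Set.Icc t₀ T)) (hb : ContinuousOn b (Set.Icc t₀ T))
    (hΦ : ContinuousOn (Function.uncurry Φ) (Set.Icc t₀ T ×ˢ Set.univ))
    (hΨ : ContinuousOn (Function.uncurry Ψ) (Set.Icc t₀ T ×ˢ Set.univ))
    (hq : ContinuousOn q (Set.Icc t₀ T)) (hΦ0 : Φ t₀ 0 = 0) (hΨ0 : Ψ t₀ 0 = 0)
    (h : ∀ s, t₀ < s → s ≤ T → ∀ (a : ℝ → ℝ) (ξ : ℝ → E), Continuous a →
      ∫ t in t₀..s, a t ^ 2 = 1 → ξ t₀ = 0 → ξ s = 0 →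
      (∀ t ∈ Set.Icc t₀ s,
        HasDerivWithinAt ξ (A t (ξ t) + a t • b t) (Set.Icc t₀ s) t) →
      κ ≤ ∫ t in t₀..s, (Φ t (ξ t) + a t * Ψ t (ξ t) + a t ^ 2 * q t)) :
    κ ≤ q t₀ := by
  refine le_of_forall_pos_le_add fun η' hη' => ?_
  -- Error budget: with `Φ`, `Ψ` and `q - q t₀` all below `η`, and `2|a| ≤ 1 + a²`, the integrand is
  -- at most `2η + (q t₀ + 2η) a²`. Its integral is at most `q t₀ + 4η`, since the interval has
  -- length less than `1` and `∫ a² = 1`.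
  obtain ⟨η, hη, rfl⟩ : ∃ η > 0, η' = 4 * η := ⟨η' / 4, by positivity, by ring⟩
  have ht₀ : t₀ ∈ Set.Icc t₀ T := Set.left_mem_Icc.2 hlt.le
  have hmem : ((t₀, 0) : ℝ × E) ∈ Set.Icc t₀ T ×ˢ (Set.univ : Set E) := ⟨ht₀, trivial⟩
  obtain ⟨δ₁, hδ₁, h₁⟩ := Metric.continuousWithinAt_iff.1 (hΦ _ hmem) η hη
  obtain ⟨δ₂, hδ₂, h₂⟩ := Metric.continuousWithinAt_iff.1 (hΨ _ hmem) η hη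
  obtain ⟨δ₃, hδ₃, h₃⟩ := Metric.continuousWithinAt_iff.1 (hq _ ht₀) η hη
  obtain ⟨δ, hδ, hlt'⟩ := exists_between
    (show (0 : ℝ) < min (min δ₁ δ₂) (min δ₃ 1) by positivity)
  obtain ⟨⟨l₁, l₂⟩, l₃, l₄⟩ : (δ < δ₁ ∧ δ < δ₂) ∧ δ < δ₃ ∧ δ < 1 := by
    simpa only [lt_min_iff] using hlt'
  obtain ⟨s, hts, hsT, hsδ, a, ξ, ha, h1, h0, hs, hode, hsmall⟩ :=
    exists_concentrated_control hlt hA hb hδ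
  have hsub : Set.Icc t₀ s ⊆ Set.Icc t₀ T := Set.Icc_subset_Icc_right hsT
  have hξ : ContinuousOn ξ (Set.Icc t₀ s) := fun t ht => (hode t ht).continuousWithinAt
  have hpair : ContinuousOn (fun t => (t, ξ t)) (Set.Icc t₀ s) := continuousOn_id.prodMk hξ
  have hmaps : Set.MapsTo (fun t => (t, ξ t)) (Set.Icc t₀ s) (Set.Icc t₀ T ×ˢ Set.univ) :=
    fun t ht => ⟨hsub ht, trivial⟩
  have hcΦ : ContinuousOn (fun t => Φ t (ξ t)) (Set.Icc t₀ s) := hΦ.comp hpair hmaps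
  have hcΨ : ContinuousOn (fun t => Ψ t (ξ t)) (Set.Icc t₀ s) := hΨ.comp hpair hmaps
  have hi2 : IntervalIntegrable (fun t => a t ^ 2) volume t₀ s :=
    (ha.pow 2).intervalIntegrable _ _
  have hle : ∫ t in t₀..s, (Φ t (ξ t) + a t * Ψ t (ξ t) + a t ^ 2 * q t)
      ≤ ∫ t in t₀..s, (2 * η + (q t₀ + 2 * η) * a t ^ 2) := by
    refine intervalIntegral.integral_mono_on hts.le (ContinuousOn.intervalIntegrable ?_)
      ((by fun_prop : Continuous fun t => 2 * η + (q t₀ + 2 * η) * a t ^ 2).intervalIntegrable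
        _ _) fun t ht => ?_
    · rw [Set.uIcc_of_le hts.le]
      exact (hcΦ.add (ha.continuousOn.mul hcΨ)).add
        ((ha.pow 2).continuousOn.mul (hq.mono hsub))
    · have hd : dist t t₀ ≤ δ := by
        rw [Real.dist_eq, abs_of_nonneg (sub_nonneg.2 ht.1)]
        linarith [ht.2]
      have hd2 : dist ((t, ξ t) : ℝ × E) (t₀, 0) ≤ δ :=
        max_le hd (by simpa using hsmall t ht)
      have b₁ := h₁ (hmaps ht) (hd2.trans_lt l₁)
      have b₂ := h₂ (hmaps ht) (hd2.trans_lt l₂)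
      have b₃ := h₃ (hsub ht) (hd.trans_lt l₃)
      simp only [Function.uncurry_apply_pair, hΦ0, hΨ0, Real.dist_eq, sub_zero] at b₁ b₂ b₃
      have c₁ := (abs_lt.1 b₁).2
      have c₃ := (abs_lt.1 b₃).2
      have c₂ : a t * Ψ t (ξ t) ≤ |a t| * η := by
        refine (le_abs_self _).trans ?_
        rw [abs_mul]
        gcongr
      have c₄ : 2 * |a t| ≤ 1 + a t ^ 2 := by
        nlinarith [sq_nonneg (|a t| - 1), sq_abs (a t)]
      have c₅ : a t ^ 2 * q t ≤ a t ^ 2 * (q t₀ + η) := by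
        gcongr
        linarith
      nlinarith [sq_nonneg (a t)]
  rw [intervalIntegral.integral_add (by simp) (hi2.const_mul _),
    intervalIntegral.integral_const, intervalIntegral.integral_const_mul, h1,
    smul_eq_mul] at hle
  have hk := h s hts hsT a ξ ha h1 h0 hs hode
  nlinarith

end LinearODE

/-! ### Regularity of partial derivatives with parameters -/

section Partial

variable {G : Type*} [NormedAddCommGroup G] [NormedSpace ℝ G] {a b : ℕ}

lemma contDiff_grad {k k' : WithTop ℕ∞} {h : G → (Fin a → ℝ) → ℝ} {g : G → Fin a → ℝ}
    (hh : ContDiff ℝ k' (Function.uncurry h)) (hg : ContDiff ℝ k g) (hk : k + 1 ≤ k') :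
    ContDiff ℝ k fun γ => grad (h γ) (g γ) :=
  contDiff_pi.2 fun _ => (hh.fderiv hg hk).clm_apply contDiff_const

lemma contDiff_jac_apply {k k' : WithTop ℕ∞} {h : G → (Fin a → ℝ) → Fin b → ℝ}
    {g : G → Fin a → ℝ}
    (hh : ContDiff ℝ k' (Function.uncurry h)) (hg : ContDiff ℝ k g) (hk : k + 1 ≤ k')
    (i : Fin b) (j : Fin a) : ContDiff ℝ k fun γ => jac (h γ) (g γ) i j :=
  contDiff_pi.1 ((hh.fderiv hg hk).clm_apply contDiff_const) i

lemma continuous_jac {h : G → (Fin a → ℝ) → Fin b → ℝ} {g : G → Fin a → ℝ}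
    (hh : ContDiff ℝ 1 (Function.uncurry h)) (hg : Continuous g) :
    Continuous fun γ => jac (h γ) (g γ) :=
  continuous_matrix fun i j =>
    (contDiff_jac_apply hh (contDiff_zero.2 hg) (by simp) i j).continuous

lemma continuousOn_jac {h : G → (Fin a → ℝ) → Fin b → ℝ} {g : G → Fin a → ℝ} {c : ℝ → G}
    {s : Set ℝ} (hc : ContinuousOn c s)
    (hh : ContDiff ℝ 1 (Function.uncurry h)) (hg : Continuous g) :
    ContinuousOn (fun t => jac (h (c t)) (g (c t))) s :=
  (continuous_jac hh hg).comp_continuousOn hc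

/-- Schwarz's theorem, with the entries of the Jacobian of the gradient identified with values of
the second Fréchet derivative. -/
lemma transpose_jac_grad {h : (Fin a → ℝ) → ℝ} (hh : ContDiff ℝ 2 h) (x : Fin a → ℝ) :
    (jac (grad h) x)ᵀ = jac (grad h) x := by
  have hd : Differentiable ℝ (fderiv ℝ h) :=
    (hh.fderiv_right (m := 1) (by norm_num)).differentiable one_ne_zero
  have key : ∀ i j, jac (grad h) x i j
      = fderiv ℝ (fderiv ℝ h) x (Pi.single j 1) (Pi.single i 1) := fun i j => by
    have h1 : HasFDerivAt (grad h) (ContinuousLinearMap.pi fun i =>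
        (ContinuousLinearMap.apply ℝ ℝ (Pi.single i 1 : Fin a → ℝ)).comp
          (fderiv ℝ (fderiv ℝ h) x)) x :=
      hasFDerivAt_pi.2 fun i => (ContinuousLinearMap.apply ℝ ℝ
        (Pi.single i 1 : Fin a → ℝ)).hasFDerivAt.comp x (hd x).hasFDerivAt
    simp [jac, h1.fderiv]
  ext i j
  rw [transpose_apply, key, key]
  exact (hh.contDiffAt.isSymmSndFDerivAt (by simp)) _ _

lemma continuousOn_timeDeriv {T : ℝ} (hT : 0 < T) {A : ℝ → Matrix (Fin b) (Fin a) ℝ}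
    (hA : ∀ i j, ContDiffOn ℝ 1 (fun t => A t i j) (Set.Icc 0 T)) :
    ContinuousOn (timeDeriv T A) (Set.Icc 0 T) :=
  continuousOn_pi.2 fun i => continuousOn_pi.2 fun j =>
    (hA i j).continuousOn_derivWithin (uniqueDiffOn_Icc hT) le_rfl

lemma timeDeriv_congr {T : ℝ} {A B : ℝ → Matrix (Fin b) (Fin a) ℝ}
    (h : Set.EqOn A B (Set.Icc 0 T)) : Set.EqOn (timeDeriv T A) (timeDeriv T B) (Set.Icc 0 T) :=
  fun t ht => by
    ext i j
    exact derivWithin_congr (fun s hs => by rw [h hs]) (by rw [h ht])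

lemma transpose_timeDeriv {T : ℝ} {A : ℝ → Matrix (Fin a) (Fin a) ℝ}
    (h : ∀ t, (A t)ᵀ = A t) (t : ℝ) : (timeDeriv T A t)ᵀ = timeDeriv T A t := by
  ext i j
  simp only [timeDeriv, transpose_apply, of_apply]
  congr 1
  ext s
  rw [← transpose_apply (A s), h]

end Partial

/-! ### Regularity of primitives on `[0,T]`. -/

namespace HasSobolevDeriv

variable {T : ℝ} {q : ENNReal} {a : ℕ} {x g : ℝ → Fin a → ℝ}

lemma continuousOn (h : HasSobolevDeriv T q x g) (hq : 1 ≤ q) (hT : 0 < T) :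
    ContinuousOn x (Set.Icc 0 T) := by
  have : IsFiniteMeasure (timeMeasure T) := by unfold timeMeasure; infer_instance
  have hint : IntegrableOn g (Set.Icc 0 T) := h.1.integrable hq
  refine ContinuousOn.congr ?_ h.2
  have hi : IntervalIntegrable g volume 0 T :=
    (intervalIntegrable_iff_integrableOn_Icc_of_le hT.le).2 hint
  have := intervalIntegral.continuousOn_primitive_interval' hi Set.left_mem_uIcc
  rw [Set.uIcc_of_le hT.le] at this
  exact continuousOn_const.add this

lemma contDiffOn (h : HasSobolevDeriv T q x g) (hT : 0 < T)
    (hg : ContinuousOn g (Set.Icc 0 T)) : ContDiffOn ℝ 1 x (Set.Icc 0 T) := by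
  -- Extending `g` by its endpoint values gives a continuous function on the whole line. Its
  -- primitive is `C¹` everywhere and equals `x` on `[0,T]`, so the endpoints need no separate
  -- treatment.
  set g' := Set.IccExtend hT.le ((Set.Icc 0 T).domRestrict g) with hg'
  have hc : Continuous g' := (continuousOn_iff_continuous_domRestrict.1 hg).Icc_extend'
  have hderiv : ∀ t, HasDerivAt (fun t => x 0 + ∫ s in (0 : ℝ)..t, g' s) (g' t) t := fun t =>
    (intervalIntegral.integral_hasDerivAt_right (hc.intervalIntegrable _ _)
      (hc.stronglyMeasurableAtFilter _ _) hc.continuousAt).const_add _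
  have hC : ContDiff ℝ 1 fun t => x 0 + ∫ s in (0 : ℝ)..t, g' s :=
    contDiff_one_iff_deriv.2 ⟨fun t => (hderiv t).differentiableAt, by
      rwa [show deriv (fun t => x 0 + ∫ s in (0 : ℝ)..t, g' s) = g' from
        funext fun t => (hderiv t).deriv]⟩
  refine hC.contDiffOn.congr fun t ht => ?_
  rw [h.2 t ht]
  congr 1
  refine intervalIntegral.integral_congr fun s hs => ?_
  rw [Set.uIcc_of_le ht.1] at hs
  rw [hg', Set.IccExtend_of_mem _ _ ⟨hs.1, hs.2.trans ht.2⟩]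
  rfl

end HasSobolevDeriv

/-! ### Time regularity of the coefficients along the reference trajectory. -/

namespace Problem

variable {n l m dφ dη : ℕ} {P : Problem n l m dφ dη} {w : Point n l m} {μ : Mult n dφ dη}

section Parameters

variable {G : Type*} [NormedAddCommGroup G] [NormedSpace ℝ G]
  {p x : G → Fin n → ℝ} {u : G → Fin l → ℝ} {v : G → Fin m → ℝ} {k : WithTop ℕ∞}

lemma Regular.contDiff_f (h : P.Regular) (hk : k ≤ 2) (hx : ContDiff ℝ k x)
    (hu : ContDiff ℝ k u) (i : Fin (m + 1)) : ContDiff ℝ k fun γ => P.f i (x γ, u γ) :=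
  ((h.1 i).1.of_le hk).comp (hx.prodMk hu)

lemma Regular.contDiff_F (h : P.Regular) (hk : k ≤ 2) (hx : ContDiff ℝ k x)
    (hu : ContDiff ℝ k u) (hv : ContDiff ℝ k v) :
    ContDiff ℝ k fun γ => P.F (x γ) (u γ) (v γ) := by
  refine ContDiff.sum fun i _ => ContDiff.fun_smul ?_ (h.contDiff_f hk hx hu i)
  refine Fin.cases ?_ (fun j => ?_) i
  · simpa using contDiff_const
  · simpa using contDiff_pi.1 hv j

lemma contDiff_dotProduct {c : ℕ} {y z : G → Fin c → ℝ} (hy : ContDiff ℝ k y)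
    (hz : ContDiff ℝ k z) : ContDiff ℝ k fun γ => y γ ⬝ᵥ z γ :=
  ContDiff.sum fun i _ => (contDiff_pi.1 hy i).mul (contDiff_pi.1 hz i)

lemma Regular.contDiff_H (h : P.Regular) (hk : k ≤ 2) (hp : ContDiff ℝ k p)
    (hx : ContDiff ℝ k x) (hu : ContDiff ℝ k u) (hv : ContDiff ℝ k v) :
    ContDiff ℝ k fun γ => P.H (p γ) (x γ) (u γ) (v γ) :=
  contDiff_dotProduct hp (h.contDiff_F hk hx hu hv)

end Parameters

lemma grad_H_v (p x : Fin n → ℝ) (u : Fin l → ℝ) (v : Fin m → ℝ) :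
    grad (fun v => P.H p x u v) v = fun i => p ⬝ᵥ P.f i.succ (x, u) := by
  have hH : (fun v => P.H p x u v)
      = fun v => p ⬝ᵥ P.f 0 (x, u) + ∑ i, v i * (p ⬝ᵥ P.f i.succ (x, u)) := by
    ext v
    simp [H, F, Fin.sum_univ_succ, dotProduct_add, dotProduct_sum, dotProduct_smul]
  have hd := (HasFDerivAt.fun_sum fun i (_ : i ∈ Finset.univ) =>
    (hasFDerivAt_apply (𝕜 := ℝ) i v).mul_const (p ⬝ᵥ P.f i.succ (x, u))).const_add
      (p ⬝ᵥ P.f 0 (x, u))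
  ext i
  simp [grad, hH, hd.fderiv, Pi.single_apply]

/-- Since `H` is affine in `v`, `H_vx` contains only first derivatives of the fields `f_i`. With
`C²` data it is therefore `C¹` in time, unlike the other second-order blocks, which are only shown
to be continuous. This makes the time derivatives of `H_vx` and `S` in `M` and `R` continuous. -/
lemma Hvx_eq (t : ℝ) : P.Hvx w μ t =
    jac (fun x i => μ.2.2 t ⬝ᵥ P.f i.succ (x, w.u t)) (w.x t) := by
  simp only [Hvx, grad_H_v]

/-- Data, reference trajectory and costate are `C¹` in time. -/
structure SmoothAlong (P : Problem n l m dφ dη) (w : Point n l m) (μ : Mult n dφ dη) :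
    Prop where
  pos : 0 < P.T
  regular : P.Regular
  x : ContDiffOn ℝ 1 w.x (Set.Icc 0 P.T)
  u : ContDiffOn ℝ 1 w.u (Set.Icc 0 P.T)
  v : ContDiffOn ℝ 1 w.v (Set.Icc 0 P.T)
  p : ContDiffOn ℝ 1 μ.2.2 (Set.Icc 0 P.T)

/-- Bootstrapping: state and costate are continuous as primitives, so the right-hand sides of their
equations are continuous along the trajectory, and both are `C¹`. -/
theorem smoothAlong (hT : 0 < P.T) (hreg : P.Regular) (hw : P.IsFeasible w)
    (hu : ContDiffOn ℝ 1 w.u (Set.Icc 0 P.T)) (hv : ContDiffOn ℝ 1 w.v (Set.Icc 0 P.T))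
    (hμ : P.IsMultiplier w μ) : P.SmoothAlong w μ := by
  have hx0 := hw.state_eq.continuousOn le_top hT
  have hp0 := hμ.costate.continuousOn le_top hT
  refine ⟨hT, hreg, hw.state_eq.contDiffOn hT ?_, hu, hv, hμ.costate.contDiffOn hT ?_⟩
  · have := (hreg.contDiff_F (k := 0) (by simp) contDiff_fst (contDiff_fst.comp contDiff_snd)
      (contDiff_snd.comp contDiff_snd)).continuous
    exact this.comp_continuousOn (hx0.prodMk (hu.continuousOn.prodMk hv.continuousOn))
  · have := (contDiff_grad (k := 0) (k' := 2)
      (G := (Fin n → ℝ) × (Fin n → ℝ) × (Fin l → ℝ) × (Fin m → ℝ))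
      (h := fun z x => P.H z.1 x z.2.2.1 z.2.2.2) (g := fun z => z.2.1)
      (hreg.contDiff_H le_rfl (by fun_prop) (by fun_prop) (by fun_prop) (by fun_prop))
      (by fun_prop) (by norm_num)).continuous
    exact (this.comp_continuousOn
      (hp0.prodMk (hx0.prodMk (hu.continuousOn.prodMk hv.continuousOn)))).neg

namespace SmoothAlong


/-- The space of `(p, x, u, v)`. -/
abbrev Phase (n l m : ℕ) : Type :=
  (Fin n → ℝ) × (Fin n → ℝ) × (Fin l → ℝ) × (Fin m → ℝ)

lemma curve (h : P.SmoothAlong w μ) :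
    ContDiffOn ℝ 1 (fun t => (μ.2.2 t, w.x t, w.u t, w.v t)) (Set.Icc 0 P.T) :=
  h.p.prodMk (h.x.prodMk (h.u.prodMk h.v))

lemma continuousOn_Fx (h : P.SmoothAlong w μ) : ContinuousOn (P.Fx w) (Set.Icc 0 P.T) := by
  have := continuousOn_jac h.curve.continuousOn (G := Phase n l m)
    (h := fun z x => P.F x z.2.2.1 z.2.2.2)
    (g := fun z => z.2.1)
    (h.regular.contDiff_F one_le_two (by fun_prop) (by fun_prop) (by fun_prop))
    (by fun_prop)
  exact this

lemma continuousOn_Fu (h : P.SmoothAlong w μ) : ContinuousOn (P.Fu w) (Set.Icc 0 P.T) := by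
  have := continuousOn_jac h.curve.continuousOn (G := Phase n l m)
    (h := fun z u => P.F z.2.1 u z.2.2.2)
    (g := fun z => z.2.2.1)
    (h.regular.contDiff_F one_le_two (by fun_prop) (by fun_prop) (by fun_prop))
    (by fun_prop)
  exact this

lemma contDiffOn_Fv (h : P.SmoothAlong w μ) (i : Fin n) (j : Fin m) :
    ContDiffOn ℝ 1 (fun t => P.Fv w t i j) (Set.Icc 0 P.T) :=
  (contDiff_jac_apply (k := 1) (k' := 2) (G := Phase n l m)
    (h := fun z v => P.F z.2.1 z.2.2.1 v) (g := fun z => z.2.2.2)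
    (h.regular.contDiff_F le_rfl (by fun_prop) (by fun_prop) (by fun_prop))
    (by fun_prop) (by norm_num) i j).comp_contDiffOn h.curve

lemma contDiffOn_Hvx (h : P.SmoothAlong w μ) (i : Fin m) (j : Fin n) :
    ContDiffOn ℝ 1 (fun t => P.Hvx w μ t i j) (Set.Icc 0 P.T) := by
  simp only [Hvx_eq]
  exact (contDiff_jac_apply (k := 1) (k' := 2) (G := Phase n l m)
    (h := fun z x i => z.1 ⬝ᵥ P.f i.succ (x, z.2.2.1)) (g := fun z => z.2.1)
    (contDiff_pi.2 fun i => contDiff_dotProduct (by fun_prop)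
      (h.regular.contDiff_f le_rfl (by fun_prop) (by fun_prop) _))
    (by fun_prop) (by norm_num) i j).comp_contDiffOn h.curve

lemma continuousOn_Fv (h : P.SmoothAlong w μ) : ContinuousOn (P.Fv w) (Set.Icc 0 P.T) :=
  continuousOn_pi.2 fun i => continuousOn_pi.2 fun j => (h.contDiffOn_Fv i j).continuousOn

lemma continuousOn_Hvx (h : P.SmoothAlong w μ) : ContinuousOn (P.Hvx w μ) (Set.Icc 0 P.T) :=
  continuousOn_pi.2 fun i => continuousOn_pi.2 fun j => (h.contDiffOn_Hvx i j).continuousOn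

lemma contDiff_grad_H_u (h : P.Regular) : ContDiff ℝ 1 fun z : Phase n l m =>
    grad (fun u => P.H z.1 z.2.1 u z.2.2.2) z.2.2.1 :=
  contDiff_grad (k' := 2) (h := fun (z : Phase n l m) u => P.H z.1 z.2.1 u z.2.2.2)
    (g := fun z => z.2.2.1)
    (h.contDiff_H le_rfl (by fun_prop) (by fun_prop) (by fun_prop) (by fun_prop))
    (by fun_prop) (by norm_num)

lemma contDiff_grad_H_x (h : P.Regular) : ContDiff ℝ 1 fun z : Phase n l m =>
    grad (fun x => P.H z.1 x z.2.2.1 z.2.2.2) z.2.1 :=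
  contDiff_grad (k' := 2) (h := fun (z : Phase n l m) x => P.H z.1 x z.2.2.1 z.2.2.2)
    (g := fun z => z.2.1)
    (h.contDiff_H le_rfl (by fun_prop) (by fun_prop) (by fun_prop) (by fun_prop))
    (by fun_prop) (by norm_num)

lemma continuousOn_Hxx (h : P.SmoothAlong w μ) : ContinuousOn (P.Hxx w μ) (Set.Icc 0 P.T) := by
  have := continuousOn_jac h.curve.continuousOn (G := Phase n l m)
    (h := fun z x => grad (fun x' => P.H z.1 x' z.2.2.1 z.2.2.2) x) (g := fun z => z.2.1)
    ((contDiff_grad_H_x h.regular).comp (g := fun z : Phase n l m =>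
      grad (fun x => P.H z.1 x z.2.2.1 z.2.2.2) z.2.1)
      (f := fun y : Phase n l m × (Fin n → ℝ) => (y.1.1, y.2, y.1.2.2)) (by fun_prop))
    (by fun_prop)
  exact this

lemma continuousOn_Hux (h : P.SmoothAlong w μ) : ContinuousOn (P.Hux w μ) (Set.Icc 0 P.T) := by
  have := continuousOn_jac h.curve.continuousOn (G := Phase n l m)
    (h := fun z x => grad (fun u => P.H z.1 x u z.2.2.2) z.2.2.1) (g := fun z => z.2.1)
    ((contDiff_grad_H_u h.regular).comp (g := fun z : Phase n l m =>
      grad (fun u => P.H z.1 z.2.1 u z.2.2.2) z.2.2.1)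
      (f := fun y : Phase n l m × (Fin n → ℝ) => (y.1.1, y.2, y.1.2.2)) (by fun_prop))
    (by fun_prop)
  exact this

lemma continuousOn_Huu (h : P.SmoothAlong w μ) : ContinuousOn (P.Huu w μ) (Set.Icc 0 P.T) := by
  have := continuousOn_jac h.curve.continuousOn (G := Phase n l m)
    (h := fun z u => grad (fun u' => P.H z.1 z.2.1 u' z.2.2.2) u) (g := fun z => z.2.2.1)
    ((contDiff_grad_H_u h.regular).comp (g := fun z : Phase n l m =>
      grad (fun u => P.H z.1 z.2.1 u z.2.2.2) z.2.2.1)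
      (f := fun y : Phase n l m × (Fin l → ℝ) => (y.1.1, y.1.2.1, y.2, y.1.2.2.2))
      (by fun_prop))
    (by fun_prop)
  exact this

lemma continuousOn_mul {a b c : ℕ} {s : Set ℝ} {A : ℝ → Matrix (Fin a) (Fin b) ℝ}
    {B : ℝ → Matrix (Fin b) (Fin c) ℝ} (hA : ContinuousOn A s) (hB : ContinuousOn B s) :
    ContinuousOn (fun t => A t * B t) s :=
  (continuous_fst.matrix_mul continuous_snd).comp_continuousOn (hA.prodMk hB)

lemma continuousOn_transpose {a b : ℕ} {s : Set ℝ} {A : ℝ → Matrix (Fin a) (Fin b) ℝ}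
    (hA : ContinuousOn A s) : ContinuousOn (fun t => (A t)ᵀ) s :=
  continuous_id.matrix_transpose.comp_continuousOn hA

lemma continuousOn_B (h : P.SmoothAlong w μ) : ContinuousOn (P.B w) (Set.Icc 0 P.T) :=
  (continuousOn_mul h.continuousOn_Fx h.continuousOn_Fv).sub
    (continuousOn_timeDeriv h.pos h.contDiffOn_Fv)

lemma continuousOn_M (h : P.SmoothAlong w μ) : ContinuousOn (P.M w μ) (Set.Icc 0 P.T) :=
  ((continuousOn_mul (continuousOn_transpose h.continuousOn_Fv) h.continuousOn_Hxx).sub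
    (continuousOn_timeDeriv h.pos h.contDiffOn_Hvx)).sub
      (continuousOn_mul h.continuousOn_Hvx h.continuousOn_Fx)

lemma continuousOn_E (h : P.SmoothAlong w μ) : ContinuousOn (P.E w μ) (Set.Icc 0 P.T) :=
  (continuousOn_mul (continuousOn_transpose h.continuousOn_Fv)
    (continuousOn_transpose h.continuousOn_Hux)).sub
      (continuousOn_mul h.continuousOn_Hvx h.continuousOn_Fu)

lemma contDiffOn_S (h : P.SmoothAlong w μ) (i j : Fin m) :
    ContDiffOn ℝ 1 (fun t => P.S w μ t i j) (Set.Icc 0 P.T) := by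
  have hs : ∀ i j, ContDiffOn ℝ 1 (fun t => (P.Hvx w μ t * P.Fv w t) i j) (Set.Icc 0 P.T) :=
    fun i j => ContDiffOn.sum (s := Finset.univ) fun k _ => (h.contDiffOn_Hvx i k).mul (h.contDiffOn_Fv k j)
  exact contDiffOn_const.mul ((hs i j).add (hs j i))

lemma continuousOn_R (h : P.SmoothAlong w μ) : ContinuousOn (P.R w μ) (Set.Icc 0 P.T) := by
  have hB := continuousOn_mul h.continuousOn_Hvx h.continuousOn_B
  exact ((continuousOn_mul (continuousOn_mul (continuousOn_transpose h.continuousOn_Fv)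
    h.continuousOn_Hxx) h.continuousOn_Fv).sub
      (hB.add (continuousOn_transpose hB))).sub
      (continuousOn_timeDeriv h.pos h.contDiffOn_S)

end SmoothAlong

/-! ### Symmetry of the second-order blocks. -/

lemma Regular.transpose_Hxx (h : P.Regular) (t : ℝ) : (P.Hxx w μ t)ᵀ = P.Hxx w μ t :=
  transpose_jac_grad (h.contDiff_H le_rfl contDiff_const contDiff_id contDiff_const
    contDiff_const) _

lemma Regular.transpose_Huu (h : P.Regular) (t : ℝ) : (P.Huu w μ t)ᵀ = P.Huu w μ t :=
  transpose_jac_grad (h.contDiff_H le_rfl contDiff_const contDiff_const contDiff_id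
    contDiff_const) _

lemma transpose_S (t : ℝ) : (P.S w μ t)ᵀ = P.S w μ t := by
  simp [S, transpose_add, add_comm]

lemma Regular.transpose_R (h : P.Regular) (t : ℝ) : (P.R w μ t)ᵀ = P.R w μ t := by
  rw [R]
  simp only [transpose_sub, transpose_add, transpose_mul, transpose_transpose,
    transpose_timeDeriv transpose_S, h.transpose_Hxx, Matrix.mul_assoc]
  rw [add_comm (_ * _)]

end Problem

namespace Problem

/-! ### Dependence on the multiplier -/

variable {n l m dφ dη : ℕ} {P : Problem n l m dφ dη} {w : Point n l m} {μ ν : Mult n dφ dη}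

/-- Uniqueness determines the costate on `[0,T]` only. That is enough, because the form samples it
only there and the time derivatives are taken within `[0,T]`. -/
lemma OmegaP2_congr (hT : 0 ≤ P.T) (h₁ : ν.1 = μ.1) (h₂ : ν.2.1 = μ.2.1)
    (h : Set.EqOn ν.2.2 μ.2.2 (Set.Icc 0 P.T)) (d : TDir n l m) :
    P.OmegaP2 w ν d = P.OmegaP2 w μ d := by
  have hvx : Set.EqOn (P.Hvx w ν) (P.Hvx w μ) (Set.Icc 0 P.T) := fun t ht => by
    simp only [Hvx, h ht]
  have hS : Set.EqOn (P.S w ν) (P.S w μ) (Set.Icc 0 P.T) := fun t ht => by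
    simp only [S, hvx ht]
  have hTm : P.T ∈ Set.Icc 0 P.T := Set.right_mem_Icc.2 hT
  have hell : P.ell ν = P.ell μ := by
    ext q
    simp only [ell, h₁, h₂]
  unfold OmegaP2
  congr 1
  · simp only [g, D2ell, hell, hvx hTm, hS hTm]
  · refine intervalIntegral.integral_congr fun t ht => ?_
    rw [Set.uIcc_of_le hT] at ht
    simp only [Hxx, Hux, Huu, M, E, R, hvx ht, h ht, timeDeriv_congr hvx ht,
      timeDeriv_congr hS ht]

/-- The triples agreeing with `μ` on `[0,T]` form a convex set containing all multipliers, so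
passing to the convex hull adds nothing new. -/
lemma IsUniqueMultiplier.eq_of_mem_GcoSharp (h : P.IsUniqueMultiplier w μ)
    (hν : ν ∈ P.GcoSharp w) :
    ν.1 = μ.1 ∧ ν.2.1 = μ.2.1 ∧ Set.EqOn ν.2.2 μ.2.2 (Set.Icc 0 P.T) := by
  have hconv : Convex ℝ {ν : Mult n dφ dη |
      ν.1 = μ.1 ∧ ν.2.1 = μ.2.1 ∧ Set.EqOn ν.2.2 μ.2.2 (Set.Icc 0 P.T)} := by
    rintro x ⟨hx₁, hx₂, hx₃⟩ y ⟨hy₁, hy₂, hy₃⟩ a b _ _ hab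
    refine ⟨?_, ?_, fun t ht => ?_⟩
    · simp [hx₁, hy₁, ← add_smul, hab]
    · simp [hx₂, hy₂, ← add_smul, hab]
    · simp [hx₃ ht, hy₃ ht, ← add_smul, hab]
  exact convexHull_min (fun ν hν => h.2 ν hν.1) hconv hν.1

lemma UniformPositivity.le_OmegaP2 {ρ : ℝ} (hpos : P.UniformPositivity w ρ)
    (hμ : P.IsUniqueMultiplier w μ) (hT : 0 ≤ P.T) {d : TDir n l m} (hd : d ∈ P.P2 w) :
    ρ * P.gammaP d ≤ P.OmegaP2 w μ d := by
  obtain ⟨c, ⟨⟨ν, hν, rfl⟩, -⟩, hc⟩ := hpos d hd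
  obtain ⟨h₁, h₂, h₃⟩ := hμ.eq_of_mem_GcoSharp hν
  exact hc.trans_eq (OmegaP2_congr hT h₁ h₂ h₃ d)

end Problem

/-! ### Directions supported on a subinterval -/

section Indicator

variable {E : Type*} [NormedAddCommGroup E] {f : ℝ → E} {t₀ s t T : ℝ}

lemma integral_indicator_Icc [NormedSpace ℝ E] (ht₀ : 0 ≤ t₀) (hts : t₀ ≤ s) (hst : s ≤ t) :
    ∫ r in (0 : ℝ)..t, (Set.Icc t₀ s).indicator f r = ∫ r in t₀..s, f r := by
  rw [intervalIntegral.integral_of_le (by linarith), ← integral_Icc_eq_integral_Ioc,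
    setIntegral_indicator measurableSet_Icc, Set.Icc_inter_Icc, max_eq_right ht₀,
    min_eq_right hst, integral_Icc_eq_integral_Ioc, intervalIntegral.integral_of_le hts]

lemma integral_indicator_Icc_of_mem [NormedSpace ℝ E] (ht₀ : 0 ≤ t₀) (ht : t ∈ Set.Icc t₀ s) :
    ∫ r in (0 : ℝ)..t, (Set.Icc t₀ s).indicator f r = ∫ r in t₀..t, f r := by
  rw [intervalIntegral.integral_of_le (ht₀.trans ht.1), ← integral_Icc_eq_integral_Ioc,
    setIntegral_indicator measurableSet_Icc, Set.Icc_inter_Icc, max_eq_right ht₀,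
    min_eq_left ht.2, integral_Icc_eq_integral_Ioc, intervalIntegral.integral_of_le ht.1]

lemma integral_indicator_Icc_of_lt [NormedSpace ℝ E] (ht : 0 ≤ t) (htt : t < t₀) :
    ∫ r in (0 : ℝ)..t, (Set.Icc t₀ s).indicator f r = 0 := by
  rw [intervalIntegral.integral_of_le ht, ← integral_Icc_eq_integral_Ioc,
    setIntegral_indicator measurableSet_Icc, Set.Icc_inter_Icc, Set.Icc_eq_empty,
    setIntegral_empty]
  exact fun h => (htt.trans_le (le_max_right _ _)).not_ge (h.trans (min_le_left _ _))

lemma memLp_indicator_Icc {q : ENNReal} (hf : ContinuousOn f (Set.Icc t₀ s)) :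
    MemLp ((Set.Icc t₀ s).indicator f) q (timeMeasure T) := by
  have : IsFiniteMeasure (timeMeasure T) := by unfold timeMeasure; infer_instance
  obtain ⟨C, hC⟩ := isCompact_Icc.exists_bound_of_continuousOn hf
  refine MemLp.of_bound ?_ (max C 0) (Filter.Eventually.of_forall fun r => ?_)
  · exact ((aestronglyMeasurable_indicator_iff measurableSet_Icc).2
      (hf.aestronglyMeasurable measurableSet_Icc)).mono_measure Measure.restrict_le_self
  · by_cases hr : r ∈ Set.Icc t₀ s
    · rw [Set.indicator_of_mem hr]
      exact (hC r hr).trans (le_max_left _ _)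
    · rw [Set.indicator_of_notMem hr, norm_zero]
      exact le_max_right _ _

/-- Since `x` vanishes at both ends of `[t₀, s]`, its extension by zero has no jump and remains a
primitive of the extended derivative. -/
lemma hasSobolevDeriv_indicator {a : ℕ} {x g : ℝ → Fin a → ℝ} {q : ENNReal} (ht₀ : 0 ≤ t₀)
    (hts : t₀ ≤ s)
    (hx : ∀ t ∈ Set.Icc t₀ s, HasDerivWithinAt x (g t) (Set.Icc t₀ s) t)
    (hg : ContinuousOn g (Set.Icc t₀ s)) (h0 : x t₀ = 0) (h1 : x s = 0) :
    HasSobolevDeriv T q ((Set.Icc t₀ s).indicator x) ((Set.Icc t₀ s).indicator g) := by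
  have hx0 : (Set.Icc t₀ s).indicator x 0 = 0 := by
    rcases ht₀.eq_or_lt with rfl | h
    · rw [Set.indicator_of_mem (Set.left_mem_Icc.2 hts), h0]
    · exact Set.indicator_of_notMem (fun hm => h.not_ge hm.1) _
  refine ⟨memLp_indicator_Icc hg, fun t ht => ?_⟩
  rw [hx0, zero_add]
  rcases lt_or_ge t t₀ with h | h
  · rw [integral_indicator_Icc_of_lt ht.1 h,
      Set.indicator_of_notMem fun hm => h.not_ge hm.1]
  rcases le_or_gt t s with h' | h'
  · rw [integral_indicator_Icc_of_mem ht₀ ⟨h, h'⟩,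
      integral_eq_sub_of_hasDerivWithinAt_Icc hx hg ⟨h, h'⟩, h0, sub_zero,
      Set.indicator_of_mem (show t ∈ Set.Icc t₀ s from ⟨h, h'⟩)]
  · rw [integral_indicator_Icc ht₀ hts h'.le,
      integral_eq_sub_of_hasDerivWithinAt_Icc hx hg (Set.right_mem_Icc.2 hts), h0, h1, sub_zero,
      Set.indicator_of_notMem fun hm => h'.not_ge hm.2]

end Indicator

/-! ### Continuity of matrix expressions. -/

lemma continuous_toContinuousLinearMap_mulVecLin {a b : ℕ} :
    Continuous fun A : Matrix (Fin a) (Fin b) ℝ =>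
      LinearMap.toContinuousLinearMap A.mulVecLin :=
  LinearMap.continuous_of_finiteDimensional
    (LinearMap.toContinuousLinearMap.toLinearMap ∘ₗ
      (Matrix.toLin' : Matrix (Fin a) (Fin b) ℝ ≃ₗ[ℝ] _).toLinearMap)

lemma continuousOn_mulVec {X : Type*} [TopologicalSpace X] {a b : ℕ} {s : Set X}
    {A : X → Matrix (Fin a) (Fin b) ℝ} {x : X → Fin b → ℝ} (hA : ContinuousOn A s)
    (hx : ContinuousOn x s) : ContinuousOn (fun t => A t *ᵥ x t) s :=
  (continuous_fst.matrix_mulVec continuous_snd).comp_continuousOn (hA.prodMk hx)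

lemma continuousOn_dotProduct {X : Type*} [TopologicalSpace X] {a : ℕ} {s : Set X}
    {x y : X → Fin a → ℝ} (hx : ContinuousOn x s) (hy : ContinuousOn y s) :
    ContinuousOn (fun t => x t ⬝ᵥ y t) s :=
  (continuous_fst.dotProduct continuous_snd).comp_continuousOn (hx.prodMk hy)

namespace Problem

variable {n l m dφ dη : ℕ} {P : Problem n l m dφ dη} {w : Point n l m} {μ : Mult n dφ dη}

/-- The direction with controls `a • u₀`, `a • y₀` and state `ξ` on `[t₀, s]`, vanishing
elsewhere. -/
def localDir (t₀ s : ℝ) (a : ℝ → ℝ) (ξ : ℝ → Fin n → ℝ) (u₀ : Fin l → ℝ) (y₀ : Fin m → ℝ) :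
    TDir n l m where
  ξ := (Set.Icc t₀ s).indicator ξ
  u := (Set.Icc t₀ s).indicator fun t => a t • u₀
  y := (Set.Icc t₀ s).indicator fun t => a t • y₀
  h := 0

section LocalDir

variable {t₀ s : ℝ} {a : ℝ → ℝ} {ξ : ℝ → Fin n → ℝ} (u₀ : Fin l → ℝ) (y₀ : Fin m → ℝ)

lemma localDir_ξ_eq_zero {t : ℝ} (ht : t ≤ t₀ ∨ s ≤ t) (h0 : ξ t₀ = 0) (h1 : ξ s = 0) :
    (localDir t₀ s a ξ u₀ y₀).ξ t = 0 := by
  by_cases hm : t ∈ Set.Icc t₀ s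
  · refine (Set.indicator_of_mem hm _).trans ?_
    rcases ht with h | h
    · rwa [le_antisymm h hm.1]
    · rwa [le_antisymm hm.2 h]
  · exact Set.indicator_of_notMem hm _

/-- The state vanishes at `0` and `T`, and `h = 0`, so every linearized endpoint constraint is
evaluated at the zero vector. Equalities and inequalities hold whatever the gradients are. -/
lemma localDir_mem_P2 (hs : P.SmoothAlong w μ) (ht₀ : 0 ≤ t₀) (hts : t₀ ≤ s) (hsT : s ≤ P.T)
    (ha : Continuous a) (h0 : ξ t₀ = 0) (h1 : ξ s = 0)
    (hξ : ∀ t ∈ Set.Icc t₀ s, HasDerivWithinAt ξ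
      (P.Fx w t *ᵥ ξ t + a t • (P.Fu w t *ᵥ u₀ + P.B w t *ᵥ y₀)) (Set.Icc t₀ s) t) :
    localDir t₀ s a ξ u₀ y₀ ∈ P.P2 w := by
  have hsub : Set.Icc t₀ s ⊆ Set.Icc 0 P.T := Set.Icc_subset_Icc ht₀ hsT
  have e0 : (localDir t₀ s a ξ u₀ y₀).ξ 0 = 0 := localDir_ξ_eq_zero u₀ y₀ (.inl ht₀) h0 h1
  have eT : (localDir t₀ s a ξ u₀ y₀).ξ P.T = 0 := localDir_ξ_eq_zero u₀ y₀ (.inr hsT) h0 h1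
  have ez : ((0 : Fin n → ℝ), (0 : Fin n → ℝ) + P.Fv w P.T *ᵥ (0 : Fin m → ℝ)) = 0 := by simp
  have eh : (localDir t₀ s a ξ u₀ y₀).h = 0 := rfl
  refine ⟨memLp_indicator_Icc (by fun_prop), memLp_indicator_Icc (by fun_prop), ?_, ?_, ?_⟩
  · have hc : ContinuousOn ξ (Set.Icc t₀ s) := fun t ht => (hξ t ht).continuousWithinAt
    change HasSobolevDeriv P.T 2 ((Set.Icc t₀ s).indicator ξ) _
    convert hasSobolevDeriv_indicator (T := P.T) (q := 2) ht₀ hts hξ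
      ((continuousOn_mulVec (hs.continuousOn_Fx.mono hsub) hc).add (ha.continuousOn.smul
        ((continuousOn_mulVec (hs.continuousOn_Fu.mono hsub) continuousOn_const).add
          (continuousOn_mulVec (hs.continuousOn_B.mono hsub) continuousOn_const)))) h0 h1 using 1
    ext1 t
    by_cases hm : t ∈ Set.Icc t₀ s
    · simp [localDir, hm, mulVec_smul, add_assoc]
    · simp [localDir, Set.indicator_of_notMem hm]
  · intro j
    rw [e0, eT, eh, ez, map_zero]
  · intro i
    rw [e0, eT, eh, ez, map_zero]

lemma gammaP_localDir (ht₀ : 0 ≤ t₀) (hts : t₀ ≤ s) (hsT : s ≤ P.T)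
    (h0 : ξ t₀ = 0) (h1 : ξ s = 0) (ha : ∫ t in t₀..s, a t ^ 2 = 1) :
    P.gammaP (localDir t₀ s a ξ u₀ y₀) = normSq u₀ + normSq y₀ := by
  have hint : ∀ t, normSq ((localDir t₀ s a ξ u₀ y₀).u t)
      + normSq ((localDir t₀ s a ξ u₀ y₀).y t)
      = (Set.Icc t₀ s).indicator (fun t => a t ^ 2 * (normSq u₀ + normSq y₀)) t := fun t => by
    by_cases hm : t ∈ Set.Icc t₀ s
    · simp [localDir, hm, normSq]
      ring
    · simp [localDir, Set.indicator_of_notMem hm, normSq]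
  rw [gammaP, localDir_ξ_eq_zero u₀ y₀ (.inl ht₀) h0 h1]
  simp only [hint, integral_indicator_Icc ht₀ hts hsT, intervalIntegral.integral_mul_const, ha]
  simp [localDir, normSq]

lemma OmegaP2_localDir (ht₀ : 0 ≤ t₀) (hts : t₀ ≤ s) (hsT : s ≤ P.T)
    (h0 : ξ t₀ = 0) (h1 : ξ s = 0) :
    P.OmegaP2 w μ (localDir t₀ s a ξ u₀ y₀) = ∫ t in t₀..s,
      ((1 / 2) * (ξ t ⬝ᵥ P.Hxx w μ t *ᵥ ξ t)
        + a t * (u₀ ⬝ᵥ P.Hux w μ t *ᵥ ξ t + y₀ ⬝ᵥ P.M w μ t *ᵥ ξ t)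
        + a t ^ 2 * ((1 / 2) * (u₀ ⬝ᵥ P.Huu w μ t *ᵥ u₀) + y₀ ⬝ᵥ P.E w μ t *ᵥ u₀
          + (1 / 2) * (y₀ ⬝ᵥ P.R w μ t *ᵥ y₀))) := by
  rw [OmegaP2, localDir_ξ_eq_zero u₀ y₀ (.inl ht₀) h0 h1,
    localDir_ξ_eq_zero u₀ y₀ (.inr hsT) h0 h1, ← integral_indicator_Icc ht₀ hts hsT]
  have hg : P.g w μ 0 0 (localDir t₀ s a ξ u₀ y₀).h = 0 := by
    simp [g, localDir, D2ell, ← Prod.zero_eq_mk]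
  rw [hg, zero_add]
  congr 1
  ext1 t
  by_cases hm : t ∈ Set.Icc t₀ s
  · simp [localDir, hm, mulVec_smul]
    ring
  · simp [localDir, Set.indicator_of_notMem hm]

end LocalDir

/-! ### The Legendre condition for the transformed problem -/

theorem legendre_of_le_OmegaP2 (hs : P.SmoothAlong w μ) {ρ : ℝ}
    (h : ∀ d ∈ P.P2 w, ρ * P.gammaP d ≤ P.OmegaP2 w μ d) (u₀ : Fin l → ℝ) (y₀ : Fin m → ℝ)
    {t : ℝ} (ht : t ∈ Set.Icc 0 P.T) :
    ρ * (normSq u₀ + normSq y₀) ≤ (1 / 2) * (u₀ ⬝ᵥ P.Huu w μ t *ᵥ u₀)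
      + y₀ ⬝ᵥ P.E w μ t *ᵥ u₀ + (1 / 2) * (y₀ ⬝ᵥ P.R w μ t *ᵥ y₀) := by
  have hq : ContinuousOn (fun t => (1 / 2) * (u₀ ⬝ᵥ P.Huu w μ t *ᵥ u₀)
      + y₀ ⬝ᵥ P.E w μ t *ᵥ u₀ + (1 / 2) * (y₀ ⬝ᵥ P.R w μ t *ᵥ y₀)) (Set.Icc 0 P.T) := by
    refine ((continuousOn_const.mul ?_).add ?_).add (continuousOn_const.mul ?_)
    · exact continuousOn_dotProduct continuousOn_const
        (continuousOn_mulVec hs.continuousOn_Huu continuousOn_const)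
    · exact continuousOn_dotProduct continuousOn_const
        (continuousOn_mulVec hs.continuousOn_E continuousOn_const)
    · exact continuousOn_dotProduct continuousOn_const
        (continuousOn_mulVec hs.continuousOn_R continuousOn_const)
  -- The test intervals extend to the right of `t₀`, which excludes `t₀ = T`. The inequality is
  -- proved on `[0,T)` and passes to the closure by continuity.
  rw [← closure_Ico hs.pos.ne] at hq ht
  refine le_on_closure (fun t₀ ht₀ => ?_) continuousOn_const hq ht
  rw [closure_Ico hs.pos.ne] at hq
  have hsub : Set.Icc t₀ P.T ⊆ Set.Icc 0 P.T := Set.Icc_subset_Icc_left ht₀.1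
  have hfst : ∀ {a b : ℕ} {A : ℝ → Matrix (Fin a) (Fin b) ℝ},
      ContinuousOn A (Set.Icc 0 P.T) → ContinuousOn (fun z : ℝ × (Fin n → ℝ) => A z.1)
        (Set.Icc t₀ P.T ×ˢ Set.univ) := fun hA =>
    (hA.mono hsub).comp continuousOn_fst fun z hz => hz.1
  -- The integrand is sorted by powers of the scalar control `a`: `Φ` is quadratic in the state, `Ψ`
  -- is linear in it and multiplies `a`, and `q` multiplies `a²`.
  refine le_of_forall_concentrated_control
    (q := fun t => (1 / 2) * (u₀ ⬝ᵥ P.Huu w μ t *ᵥ u₀)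
      + y₀ ⬝ᵥ P.E w μ t *ᵥ u₀ + (1 / 2) * (y₀ ⬝ᵥ P.R w μ t *ᵥ y₀))
    (A := fun t => LinearMap.toContinuousLinearMap (P.Fx w t).mulVecLin)
    (b := fun t => P.Fu w t *ᵥ u₀ + P.B w t *ᵥ y₀)
    (Φ := fun t x => (1 / 2) * (x ⬝ᵥ P.Hxx w μ t *ᵥ x))
    (Ψ := fun t x => u₀ ⬝ᵥ P.Hux w μ t *ᵥ x + y₀ ⬝ᵥ P.M w μ t *ᵥ x)
    ht₀.2 ?_ ?_ ?_ ?_ (hq.mono hsub) (by simp) (by simp) ?_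
  · exact continuous_toContinuousLinearMap_mulVecLin.comp_continuousOn
      (hs.continuousOn_Fx.mono hsub)
  · exact (continuousOn_mulVec (hs.continuousOn_Fu.mono hsub) continuousOn_const).add
      (continuousOn_mulVec (hs.continuousOn_B.mono hsub) continuousOn_const)
  · exact continuousOn_const.mul (continuousOn_dotProduct continuousOn_snd
      (continuousOn_mulVec (hfst hs.continuousOn_Hxx) continuousOn_snd))
  · exact (continuousOn_dotProduct continuousOn_const
      (continuousOn_mulVec (hfst hs.continuousOn_Hux) continuousOn_snd)).add
      (continuousOn_dotProduct continuousOn_const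
        (continuousOn_mulVec (hfst hs.continuousOn_M) continuousOn_snd))
  · intro s hts hsT a ξ ha h1 h0 hs1 hode
    have := h _ (localDir_mem_P2 u₀ y₀ hs ht₀.1 hts.le hsT ha h0 hs1 hode)
    rwa [gammaP_localDir u₀ y₀ ht₀.1 hts.le hsT h0 hs1 h1,
      OmegaP2_localDir u₀ y₀ ht₀.1 hts.le hsT h0 hs1] at this

/-- The two off-diagonal blocks contribute equally, so this form is exactly twice the expression
bounded below in `legendre_of_le_OmegaP2`. -/
lemma dotProduct_blockMatrix_mulVec (t : ℝ) (z : Fin l ⊕ Fin m → ℝ) :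
    z ⬝ᵥ P.blockMatrix w μ t *ᵥ z =
      (z ∘ Sum.inl) ⬝ᵥ P.Huu w μ t *ᵥ (z ∘ Sum.inl)
        + 2 * ((z ∘ Sum.inr) ⬝ᵥ P.E w μ t *ᵥ (z ∘ Sum.inl))
        + (z ∘ Sum.inr) ⬝ᵥ P.R w μ t *ᵥ (z ∘ Sum.inr) := by
  have hE : (z ∘ Sum.inl) ⬝ᵥ (P.E w μ t)ᵀ *ᵥ (z ∘ Sum.inr)
      = (z ∘ Sum.inr) ⬝ᵥ P.E w μ t *ᵥ (z ∘ Sum.inl) := by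
    rw [mulVec_transpose, dotProduct_comm, ← dotProduct_mulVec]
  rw [blockMatrix, fromBlocks_mulVec]
  conv_lhs => rw [← Sum.elim_comp_inl_inr z]
  rw [sumElim_dotProduct_sumElim]
  simp only [Sum.elim_comp_inl, Sum.elim_comp_inr, dotProduct_add, hE]
  ring

end Problem

end SingularControl

end

theorem mainTheorem9 {n l m dφ dη : ℕ} (P : SingularControl.Problem n l m dφ dη)
    (hT : 0 < P.T) (hreg : P.Regular)
    (w : SingularControl.Point n l m) (hw : P.IsFeasible w)
    (hactive : ∀ i : Fin dφ, P.φ i.succ (w.x 0, w.x P.T) = 0)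
    (hu : ContDiffOn ℝ 1 w.u (Set.Icc 0 P.T)) (hv : ContDiffOn ℝ 1 w.v (Set.Icc 0 P.T))
    (ρ : ℝ) (hρ : 0 < ρ) (hpos : P.UniformPositivity w ρ)
    (μ : SingularControl.Mult n dφ dη) (hμ : P.IsUniqueMultiplier w μ) :
    ∀ t ∈ Set.Icc (0 : ℝ) P.T,
      (P.blockMatrix w μ t - ρ • (1 : Matrix (Fin l ⊕ Fin m) (Fin l ⊕ Fin m) ℝ)).PosSemidef := by
  intro t ht
  have hs := SingularControl.Problem.smoothAlong hT hreg hw hu hv hμ.1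
  refine Matrix.PosSemidef.of_dotProduct_mulVec_nonneg ?_ fun z => ?_
  · rw [Matrix.IsHermitian, Matrix.conjTranspose_eq_transpose_of_trivial, transpose_sub,
      transpose_smul, transpose_one, SingularControl.Problem.blockMatrix, fromBlocks_transpose,
      hreg.transpose_Huu, hreg.transpose_R, transpose_transpose]
  · have hL := SingularControl.Problem.legendre_of_le_OmegaP2 hs
      (fun d hd => hpos.le_OmegaP2 hμ hT.le hd) (z ∘ Sum.inl) (z ∘ Sum.inr) ht
    have hz : z ⬝ᵥ z = SingularControl.normSq (z ∘ Sum.inl)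
        + SingularControl.normSq (z ∘ Sum.inr) := by
      simp [SingularControl.normSq, dotProduct, Fintype.sum_sum_type]
    have hz0 : 0 ≤ z ⬝ᵥ z := Finset.sum_nonneg fun i _ => mul_self_nonneg (z i)
    rw [star_trivial, sub_mulVec, smul_mulVec, one_mulVec, dotProduct_sub, dotProduct_smul,
      SingularControl.Problem.dotProduct_blockMatrix_mulVec, smul_eq_mul]
    rw [← hz] at hL
    -- `hL` bounds half of the block form below by `ρ |z|²`, so the full form is at least `2ρ |z|²`;
    -- the surplus `ρ |z|² ≥ 0` is discarded.
    nlinarith [mul_nonneg hρ.le hz0]
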